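/- **Conventions.** A finitely generated group carries the word metric (the path metric of its Cayley graph) of a finite generating set. For real numbers $A\ge 1$, $B\ge 0$, a map $f:X\to Y$ of metric spaces is an $(A,B)$-quasi-isometric embedding if $\frac1A d(x,x')-B\le d(f(x),f(x'))\le A\,d(x,x')+B$ for all $x,x'\in X$; it is a quasi-isometry if moreover, for suitable $A,B,r$, every point of $Y$ is within distance $r$ of $f(X)$. Two finitely generated groups are quasi-isometric if there is a quasi-isometry between them (this does not depend on the generating sets). A group is one-ended if it is finitely generated and its Cayley graph has exactly one end. A terminal graph of groups is a graph of groups over a finite connected graph such that all edge groups are finite and every vertex group is finite or one-ended. If $G$ is (identified with) its fundamental group, defined with respect to a spanning tree, with vertex groups $G_v\le G$, the vertex spaces of $G$ are the left cosets $gG_v$, indexed by the vertices $(v,gG_v)$ of the Bass–Serre tree. **Theorem.** (1) Let $G_1$ and $G_2$ be quasi-isometric groups, each of which is the fundamental group of a terminal graph of groups. If $H$ is a one-ended vertex group of $G_1$, then there is a one-ended vertex group of $G_2$ which is quasi-isometric to $H$. (2) Let $G$ be the fundamental group of a terminal graph of groups and let $H$ be a one-ended group, both with word metrics of finite generating sets.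 For all $A,B$ there is an $R$ such that for every $(A,B)$-quasi-isometric embedding $f:H\to G$ there is a unique vertex space $X$ of $G$ such that $f(H)$ is contained in the $R$-neighbourhood of $X$. -/

import Mathlib

universe u₁ u₂ u₃ u₄ u₅ u₆ u₇ u₈ u₉ u₁₀

/-! ### Quasi-isometries and ends of finitely generated groups -/

/-- `f` is an `(A, B)`-quasi-isometric embedding between the vertex sets of the graphs `X` and `Y`,
equipped with their path metrics (every edge has length one). -/
structure IsQuasiIsometricEmbedding {P Q : Type*} (X : SimpleGraph P) (Y : SimpleGraph Q)
    (A B : ℝ) (f : P → Q) : Prop where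
  one_le : 1 ≤ A
  nonneg : 0 ≤ B
  lower : ∀ p q, (X.dist p q : ℝ) / A - B ≤ Y.dist (f p) (f q)
  upper : ∀ p q, (Y.dist (f p) (f q) : ℝ) ≤ A * X.dist p q + B

/-- A quasi-isometry: a quasi-isometric embedding with coarsely dense image. -/
def IsQuasiIsometry {P Q : Type*} (X : SimpleGraph P) (Y : SimpleGraph Q) (f : P → Q) : Prop :=
  (∃ A B : ℝ, IsQuasiIsometricEmbedding X Y A B f) ∧ ∃ r : ℕ, ∀ q, ∃ p, Y.dist q (f p) ≤ r

/-- `S` is a finite generating set of the group `G`. -/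
def IsFiniteGeneratingSet {G : Type*} [Group G] (S : Set G) : Prop :=
  S.Finite ∧ Subgroup.closure S = ⊤

/-- The groups `G` and `H` are finitely generated, and their Cayley graphs with respect to some
finite generating sets are quasi-isometric. (All choices of finite generating sets are equivalent,
because two of them give bilipschitz equivalent word metrics.) -/
def QuasiIsometricGroups (G H : Type*) [Group G] [Group H] : Prop :=
  ∃ (S : Set G) (S' : Set H), IsFiniteGeneratingSet S ∧ IsFiniteGeneratingSet S' ∧
    ∃ f : G → H, IsQuasiIsometry (SimpleGraph.mulCayley S) (SimpleGraph.mulCayley S') f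

/-- The group `G` is finitely generated, and its Cayley graph with respect to some finite
generating set has exactly one end. (The number of ends does not depend on the generating set.) -/
def IsOneEnded (G : Type*) [Group G] : Prop :=
  ∃ S : Set G, IsFiniteGeneratingSet S ∧ Nat.card (SimpleGraph.mulCayley S).end = 1

/-! ### Graphs of groups -/

/-- A graph of groups over a graph with vertex set `V` and edge set `E` (loops and multiple edges
are allowed). Each edge `e` carries an arbitrary orientation, from `src e` to `tgt e`, and its edge
group is embedded in the vertex groups at its two endpoints. -/
structure GraphOfGroups (V : Type u₁) (E : Type u₂) where
  src : E → V
  tgt : E → V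
  vertexGroup : V → Type u₃
  edgeGroup : E → Type u₄
  [groupVertex : ∀ v, Group (vertexGroup v)]
  [groupEdge : ∀ e, Group (edgeGroup e)]
  srcHom : ∀ e, edgeGroup e →* vertexGroup (src e)
  tgtHom : ∀ e, edgeGroup e →* vertexGroup (tgt e)
  srcHom_injective : ∀ e, Function.Injective (srcHom e)
  tgtHom_injective : ∀ e, Function.Injective (tgtHom e)

namespace GraphOfGroups

attribute [instance] GraphOfGroups.groupVertex GraphOfGroups.groupEdge

variable {V : Type u₁} {E : Type u₂} (𝒢 : GraphOfGroups.{u₁, u₂, u₃, u₄} V E)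

/-- The vertices `v` and `w` are joined by a path all of whose edges lie in `T`. -/
def Joined (T : Set E) (v w : V) : Prop :=
  Relation.EqvGen (fun a b => ∃ e ∈ T, 𝒢.src e = a ∧ 𝒢.tgt e = b) v w

/-- The edges in `T`, together with all the vertices, form a tree: this subgraph is nonempty and
connected, and it has no cycle, that is, each of its edges is a bridge of it. -/
structure IsSpanningTree (T : Set E) : Prop where
  nonempty : Nonempty V
  connected : ∀ v w, 𝒢.Joined T v w
  isBridge : ∀ e ∈ T, ¬ 𝒢.Joined (T \ {e}) (𝒢.src e) (𝒢.tgt e)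

/-- The free product of all the vertex groups and of the free group on the edges. -/
abbrev FreeProduct : Type max u₁ u₂ u₃ :=
  Monoid.Coprod (Monoid.CoprodI 𝒢.vertexGroup) (FreeGroup E)

/-- An element of a vertex group, as an element of the free product. -/
def ofVertex (v : V) : 𝒢.vertexGroup v →* 𝒢.FreeProduct :=
  Monoid.Coprod.inl.comp Monoid.CoprodI.of

/-- The stable letter of an edge, as an element of the free product. -/
def stableLetter (e : E) : 𝒢.FreeProduct :=
  Monoid.Coprod.inr (FreeGroup.of e)

/-- The relators `t_e * tgtHom e a * t_e⁻¹ * (srcHom e a)⁻¹` for all edges `e` and all `a` in the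
edge group, and `t_e` for all edges `e` in `T`. -/
def relators (T : Set E) : Set 𝒢.FreeProduct :=
  {x | ∃ (e : E) (a : 𝒢.edgeGroup e),
      x = 𝒢.stableLetter e * 𝒢.ofVertex (𝒢.tgt e) (𝒢.tgtHom e a) * (𝒢.stableLetter e)⁻¹ *
        (𝒢.ofVertex (𝒢.src e) (𝒢.srcHom e a))⁻¹} ∪
  {x | ∃ e ∈ T, x = 𝒢.stableLetter e}

/-- The fundamental group of the graph of groups, relative to the spanning tree `T`. -/
def FundamentalGroup (T : Set E) : Type max u₁ u₂ u₃ :=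
  𝒢.FreeProduct ⧸ Subgroup.normalClosure (𝒢.relators T)

instance (T : Set E) : Group (𝒢.FundamentalGroup T) :=
  inferInstanceAs (Group (𝒢.FreeProduct ⧸ Subgroup.normalClosure (𝒢.relators T)))

/-- The canonical homomorphism of a vertex group to the fundamental group. -/
def vertexHom (T : Set E) (v : V) : 𝒢.vertexGroup v →* 𝒢.FundamentalGroup T :=
  (QuotientGroup.mk' (Subgroup.normalClosure (𝒢.relators T))).comp (𝒢.ofVertex v)

/-- A terminal graph of groups: the graph is finite, the edge groups are finite, and every vertex
group is finite or one-ended. -/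
structure IsTerminal : Prop where
  finite_vertices : Finite V
  finite_edges : Finite E
  finite_edgeGroup : ∀ e, Finite (𝒢.edgeGroup e)
  vertexGroup : ∀ v, Finite (𝒢.vertexGroup v) ∨ IsOneEnded (𝒢.vertexGroup v)

section Decomposition

variable {T : Set E} {G : Type*} [Group G] (φ : 𝒢.FundamentalGroup T ≃* G)

/-- The image of a vertex group in a group `G` that is identified with the fundamental group. -/
def vertexSubgroup (v : V) : Subgroup G :=
  (φ.toMonoidHom.comp (𝒢.vertexHom T v)).range

/-- The indices of the vertex spaces of `G`, that is, the vertices of the Bass-Serre tree: pairs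
of a vertex `v` and a left coset of the vertex group at `v`. -/
abbrev VertexSpaceIndex : Type _ :=
  Σ v : V, G ⧸ 𝒢.vertexSubgroup φ v

/-- The vertex space with a given index: the coset itself, as a subset of `G`. -/
def vertexSpace (X : 𝒢.VertexSpaceIndex φ) : Set G :=
  {g | (QuotientGroup.mk g : G ⧸ 𝒢.vertexSubgroup φ X.1) = X.2}

end Decomposition

end GraphOfGroups

open SimpleGraph
open scoped symmDiff Pointwise

/-! ### Word metrics -/

namespace SimpleGraph

/-! Every edge `w` of the Bass–Serre tree cuts the tree in two, and a path in `G` can change sides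
only near the coset belonging to `w` (`exists_isNearWall_base`). Edge groups are finite and there
are finitely many of them, so these cosets have uniformly bounded diameter. Pulled back by a
quasi-isometric embedding `f : H → G`, the side of `w` is therefore constant outside a ball in `H`
of uniform radius, up to one-endedness: all of `H` outside a slightly larger ball lies on a single
side. Any two of these preferred sides meet because `H` is infinite, and all but finitely many
contain the vertex of `f 1`; hence one tree vertex `X` lies in all of them
(`exists_forall_mem_side_iff`). If `f h` is not in the space `X`, the edge at `X` leading towards it
has `f h` on its wrong side, which forces this edge, and so `X`, to be close to `f h`. Uniqueness
holds since distinct vertex spaces have finite coarse intersection (`finite_near_vertexSpaces`).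

For quasi-isometric `G₁` and `G₂`, the image of `H` lies near a vertex space of `G₂`, whose group is
infinite and hence one-ended. A quasi-inverse takes that space near a vertex space of `G₁`, which
must be `H` itself. Vertex groups are undistorted (`exists_isCoarseEmbedding_incl`), so the induced
map is a quasi-isometry for their own word metrics.

No normal forms are used. Injectivity of the vertex groups and the separation property of tree edges
both come from permutation representations built with the universal property (`exists_lift`). -/

theorem Connected.dist_le_mul_of_adj {P Q : Type*} {X : SimpleGraph P} {Y : SimpleGraph Q}
    (hX : X.Connected) (hY : Y.Connected) {f : P → Q} {c : ℕ}
    (hf : ∀ p q, X.Adj p q → Y.dist (f p) (f q) ≤ c) (p q : P) :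
    Y.dist (f p) (f q) ≤ c * X.dist p q := by
  obtain ⟨w, hw⟩ := hX.exists_walk_length_eq_dist p q
  rw [← hw]
  clear hw
  induction w with
  | nil => simp
  | cons h w ih =>
    have := hY.dist_triangle (u := f _) (v := f _) (w := f _) |>.trans (add_le_add (hf _ _ h) ih)
    simpa [mul_add, add_comm] using this

theorem Connected.iff_of_forall_adj {P : Type*} {X : SimpleGraph P} (hX : X.Connected)
    {s : P → Prop} (hs : ∀ p q, X.Adj p q → (s p ↔ s q)) (p q : P) : s p ↔ s q := by
  obtain ⟨w⟩ := hX.preconnected p q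
  induction w with
  | nil => rfl
  | cons h w ih => exact (hs _ _ h).trans ih

/-- If a predicate differs at two vertices, it changes along an edge close to the first one. -/
theorem Connected.exists_adj_of_not_iff {P : Type*} {X : SimpleGraph P} (hX : X.Connected)
    {s : P → Prop} {p q : P} (h : ¬ (s p ↔ s q)) :
    ∃ a b, X.Adj a b ∧ ¬ (s a ↔ s b) ∧ X.dist p a ≤ X.dist p q := by
  obtain ⟨w, hw⟩ := hX.exists_walk_length_eq_dist p q
  rw [← hw]
  clear hw
  induction w with
  | nil => exact absurd Iff.rfl h
  | @cons u v x huv w ih =>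
    by_cases huv' : s u ↔ s v
    · obtain ⟨a, b, hab, hs, hd⟩ := ih (fun h' => h (huv'.trans h'))
      refine ⟨a, b, hab, hs, ?_⟩
      have := hX.dist_triangle (u := u) (v := v) (w := a)
      have h1 := dist_eq_one_iff_adj.2 huv
      simp only [Walk.length_cons]
      omega
    · exact ⟨u, v, huv, huv', by simp⟩

end SimpleGraph


section WordMetric

variable {G : Type*} [Group G] {S : Set G}

theorem mulCayley_connected (hS : Subgroup.closure S = ⊤) : (mulCayley S).Connected := by
  have key : ∀ x : G, ∀ g : G, (mulCayley S).Reachable g (g * x) := by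
    intro x
    have hx : x ∈ Subgroup.closure S := hS ▸ Subgroup.mem_top x
    induction hx using Subgroup.closure_induction with
    | mem x hx =>
      intro g
      by_cases h : g = g * x
      · rw [← h]
      · exact Adj.reachable ((mulCayley_adj S _ _).2 ⟨h, Or.inl (by simpa using hx)⟩)
    | one => intro g; simp
    | mul x y _ _ hx hy => intro g; rw [← mul_assoc]; exact (hx g).trans (hy (g * x))
    | inv x _ hx => intro g; simpa using (hx (g * x⁻¹)).symm
  exact { preconnected := fun g h => by simpa using key (g⁻¹ * h) g, nonempty := ⟨1⟩ }

theorem mulCayley_dist_mul_left (hS : Subgroup.closure S = ⊤) (k g h : G) :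
    (mulCayley S).dist (k * g) (k * h) = (mulCayley S).dist g h := by
  have hc := mulCayley_connected hS
  have key : ∀ k g h : G, (mulCayley S).dist (k * g) (k * h) ≤ (mulCayley S).dist g h := by
    intro k g h
    simpa using hc.dist_le_mul_of_adj hc (f := fun x => k * x) (c := 1)
      (fun p q hpq => (dist_eq_one_iff_adj.2 (mulCayley_adj_mul_iff_right.2 hpq)).le) g h
  refine le_antisymm (key k g h) ?_
  simpa using key k⁻¹ (k * g) (k * h)

theorem mulCayley_dist_eq (hS : Subgroup.closure S = ⊤) (g h : G) :
    (mulCayley S).dist g h = (mulCayley S).dist 1 (g⁻¹ * h) := by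
  rw [← mulCayley_dist_mul_left hS g⁻¹ g h, inv_mul_cancel]

theorem IsFiniteGeneratingSet.finite_ball (hS : IsFiniteGeneratingSet S) (g : G) (n : ℕ) :
    {h | (mulCayley S).dist g h ≤ n}.Finite := by
  have hc := mulCayley_connected hS.2
  induction n generalizing g with
  | zero =>
    refine (Set.finite_singleton g).subset fun h hh => ?_
    have := hc.dist_eq_zero_iff.1 (Nat.le_zero.1 hh)
    exact this.symm
  | succ n ih =>
    have hfin : (⋃ s ∈ S ∪ S⁻¹ ∪ {1}, {h | (mulCayley S).dist (g * s) h ≤ n}).Finite :=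
      ((hS.1.union hS.1.inv).union (Set.finite_singleton 1)).biUnion fun s _ => ih (g * s)
    refine hfin.subset fun h hh => ?_
    obtain ⟨w, hw⟩ := hc.exists_walk_length_eq_dist g h
    cases w with
    | nil => simp only [Set.mem_iUnion]; exact ⟨1, by simp, by simp⟩
    | @cons _ v _ hv w =>
      simp only [Set.mem_iUnion]
      refine ⟨g⁻¹ * v, ?_, ?_⟩
      · have := ((mulCayley_adj S _ _).1 hv).2
        simpa using Or.inr this
      · have h1 : (mulCayley S).dist g h ≤ n + 1 := hh
        have h2 := dist_le w
        simp only [Walk.length_cons] at hw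
        simp only [mul_inv_cancel_left, Set.mem_ofPred_eq]
        omega

/-- Finitely many bounded subsets do not cover an infinite finitely generated group. -/
theorem IsFiniteGeneratingSet.exists_far [Infinite G] (hS : IsFiniteGeneratingSet S)
    {c : Set G} (hc : c.Finite) (n : ℕ) : ∃ g : G, ∀ h ∈ c, n < (mulCayley S).dist h g := by
  obtain ⟨g, hg⟩ := (hc.biUnion fun h _ => hS.finite_ball h n).infinite_compl.nonempty
  refine ⟨g, fun h hh => ?_⟩
  by_contra hn
  exact hg (Set.mem_biUnion hh (not_lt.1 hn))

/-- Homomorphisms are Lipschitz maps for the word metrics. -/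
theorem IsFiniteGeneratingSet.exists_lipschitz {H : Type*} [Group H] {S' : Set H}
    (hS' : IsFiniteGeneratingSet S') (hS : IsFiniteGeneratingSet S) (f : H →* G) :
    ∃ c : ℕ, ∀ h k, (mulCayley S).dist (f h) (f k) ≤ c * (mulCayley S').dist h k := by
  obtain ⟨c, hc⟩ := (hS'.1.image fun s => (mulCayley S).dist 1 (f s)).bddAbove
  refine ⟨c, (mulCayley_connected hS'.2).dist_le_mul_of_adj (mulCayley_connected hS.2) ?_⟩
  intro h k hk
  obtain h' | h' := ((mulCayley_adj S' _ _).1 hk).2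
  · rw [mulCayley_dist_eq hS.2, ← map_inv, ← map_mul]
    exact hc ⟨_, h', rfl⟩
  · rw [SimpleGraph.dist_comm, mulCayley_dist_eq hS.2, ← map_inv, ← map_mul]
    exact hc ⟨_, h', rfl⟩

end WordMetric

/-! ### Quasi-isometric embeddings with integral constants -/

/-- A quasi-isometric embedding, with a single natural number as its constant. -/
def IsCoarseEmbedding {P Q : Type*} (X : SimpleGraph P) (Y : SimpleGraph Q) (a : ℕ) (f : P → Q) :
    Prop :=
  ∀ p q, Y.dist (f p) (f q) ≤ a * X.dist p q + a ∧ X.dist p q ≤ a * Y.dist (f p) (f q) + a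

theorem IsQuasiIsometricEmbedding.isCoarseEmbedding {P Q : Type*} {X : SimpleGraph P}
    {Y : SimpleGraph Q} {A B : ℝ} {f : P → Q} (hf : IsQuasiIsometricEmbedding X Y A B f) :
    IsCoarseEmbedding X Y ⌈A + B + A * B⌉₊ f := by
  intro p q
  have hA := hf.one_le
  have hB := hf.nonneg
  have hAB : 0 ≤ A * B := by positivity
  have hc := Nat.le_ceil (A + B + A * B)
  set c : ℝ := (⌈A + B + A * B⌉₊ : ℝ) with hc'
  have h1 := hf.upper p q
  have h2 := hf.lower p q
  rw [sub_le_iff_le_add, div_le_iff₀ (by linarith)] at h2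
  have hd : (0 : ℝ) ≤ X.dist p q := Nat.cast_nonneg _
  have hd' : (0 : ℝ) ≤ Y.dist (f p) (f q) := Nat.cast_nonneg _
  constructor
  · have : (Y.dist (f p) (f q) : ℝ) ≤ c * X.dist p q + c := by
      have := mul_le_mul_of_nonneg_right (show A ≤ c by linarith) hd
      linarith
    rw [hc'] at this; exact_mod_cast this
  · have : (X.dist p q : ℝ) ≤ c * Y.dist (f p) (f q) + c := by
      have := mul_le_mul_of_nonneg_right (show A ≤ c by linarith) hd'
      linarith
    rw [hc'] at this; exact_mod_cast this

theorem IsCoarseEmbedding.isQuasiIsometricEmbedding {P Q : Type*} {X : SimpleGraph P}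
    {Y : SimpleGraph Q} {a : ℕ} {f : P → Q} (hf : IsCoarseEmbedding X Y a f) :
    IsQuasiIsometricEmbedding X Y (a + 1) a f where
  one_le := by simp
  nonneg := by simp
  lower p q := by
    have h : (X.dist p q : ℝ) ≤ a * Y.dist (f p) (f q) + a := by exact_mod_cast (hf p q).2
    have ha : (0 : ℝ) ≤ a := Nat.cast_nonneg _
    rw [sub_le_iff_le_add, div_le_iff₀ (by positivity)]
    have hd' : (0 : ℝ) ≤ Y.dist (f p) (f q) := Nat.cast_nonneg _
    nlinarith [mul_nonneg ha ha]
  upper p q := by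
    have h : (Y.dist (f p) (f q) : ℝ) ≤ a * X.dist p q + a := by exact_mod_cast (hf p q).1
    have hd : (0 : ℝ) ≤ X.dist p q := Nat.cast_nonneg _
    linarith

theorem IsCoarseEmbedding.comp {P Q R : Type*} {X : SimpleGraph P} {Y : SimpleGraph Q}
    {Z : SimpleGraph R} {a b : ℕ} {f : P → Q} {g : Q → R} (hg : IsCoarseEmbedding Y Z b g)
    (hf : IsCoarseEmbedding X Y a f) : IsCoarseEmbedding X Z (a * b + a + b) (g ∘ f) := by
  intro p q
  have h1 := hf p q
  have h2 := hg (f p) (f q)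
  simp only [Function.comp]
  have h3 := Nat.mul_le_mul_left b h1.1
  have h4 := Nat.mul_le_mul_left a h2.2
  constructor <;> nlinarith

theorem IsCoarseEmbedding.finite_preimage {G H : Type*} [Group G] [Group H] {S : Set G}
    {S' : Set H} (hS' : IsFiniteGeneratingSet S') {a : ℕ} {f : H → G}
    (hf : IsCoarseEmbedding (mulCayley S') (mulCayley S) a f) {s : Set G} (hs : s.Finite) :
    (f ⁻¹' s).Finite := by
  refine hs.preimage' fun g _ => ?_
  obtain h | ⟨h, hh⟩ := (f ⁻¹' {g}).eq_empty_or_nonempty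
  · simp [h]
  · refine (hS'.finite_ball h a).subset fun k hk => ?_
    have := (hf h k).2
    rw [show f h = f k from hh.trans (Eq.symm hk)] at this
    simpa using this

/-! ### One-ended groups -/

section Ends

open CategoryTheory

namespace SimpleGraph

/-- The infinite components are exactly those in the eventual range of the inverse system of
components. The system consists of finite nonempty sets, so each of them is the value of some end.
-/
theorem componentCompl_eq_of_infinite {P : Type*} {X : SimpleGraph P} [LocallyFinite X]
    (hX : X.Preconnected) (hend : Subsingleton X.end) (K : Finset P) {C D : X.ComponentCompl K}
    (hC : C.supp.Infinite) (hD : D.supp.Infinite) : C = D := by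
  have : Fact X.Preconnected := ⟨hX⟩
  have : ∀ K, Finite (X.componentComplFunctor.obj K) := fun K => X.componentCompl_finite K.unop
  have : Infinite P := Set.infinite_univ_iff.1 (hC.mono (Set.subset_univ _))
  have : ∀ K, Nonempty (X.componentComplFunctor.obj K) :=
    fun K => X.componentCompl_nonempty_of_infinite K.unop
  have hML := X.componentComplFunctor.isMittagLeffler_of_exists_finite_range fun K =>
    ⟨K, 𝟙 K, Set.toFinite _⟩
  have := X.componentComplFunctor.toEventualRanges_nonempty hML
  have : ∀ K, Finite (X.componentComplFunctor.toEventualRanges.obj K) :=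
    X.componentComplFunctor.toEventualRanges_finite
  have hsurj := X.componentComplFunctor.toEventualRanges.eval_section_surjective_of_surjective
    (X.componentComplFunctor.surjective_toEventualRanges hML) (Opposite.op K)
  have hC' := (infinite_iff_in_eventualRange X (K := Opposite.op K) C).1 hC
  have hD' := (infinite_iff_in_eventualRange X (K := Opposite.op K) D).1 hD
  obtain ⟨s, hs⟩ := hsurj ⟨C, hC'⟩
  obtain ⟨t, ht⟩ := hsurj ⟨D, hD'⟩
  have hst : s = t := X.componentComplFunctor.toEventualRangesSectionsEquiv.injective
    (hend.elim _ _)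
  subst hst
  exact congrArg Subtype.val (hs.symm.trans ht)

/-- In a one-ended graph, a predicate that is locally constant outside a finite set is constant
outside a finite set that depends only on the first finite set. -/
theorem exists_finite_of_subsingleton_end {P : Type*} {X : SimpleGraph P} [LocallyFinite X]
    (hX : X.Preconnected) (hend : Subsingleton X.end) (K : Finset P) :
    ∃ L : Set P, L.Finite ∧ ∀ s : P → Prop,
      (∀ p q, X.Adj p q → p ∉ K → q ∉ K → (s p ↔ s q)) → ∀ p q, p ∉ L → q ∉ L → (s p ↔ s q) := by
  have : Fact X.Preconnected := ⟨hX⟩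
  -- What remains outside `K` and its finitely many finite complementary components lies in infinite
  -- components, of which there is only one.
  refine ⟨K ∪ ⋃ C : {C : X.ComponentCompl K // C.supp.Finite}, C.1.supp,
    K.finite_toSet.union (Set.finite_iUnion fun C => C.2), fun s hs p q hp hq => ?_⟩
  have key : ∀ {p}, p ∉ (K : Set P) ∪ ⋃ C : {C : X.ComponentCompl K // C.supp.Finite}, C.1.supp →
      ∃ h : p ∉ K, (X.componentComplMk (K := K) h).supp.Infinite := by
    intro p hp
    simp only [Set.mem_union, Set.mem_iUnion, not_or, not_exists] at hp
    exact ⟨hp.1, fun hfin => hp.2 ⟨_, hfin⟩ (X.componentComplMk_mem _)⟩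
  obtain ⟨hp, hpi⟩ := key hp
  obtain ⟨hq, hqi⟩ := key hq
  have heq := componentCompl_eq_of_infinite hX hend K hpi hqi
  have := congrArg (ComponentCompl.lift (K := (K : Set P)) (fun v _ => s v)
    (fun v w hv hw h => propext (hs v w h hv hw))) heq
  exact iff_of_eq this

end SimpleGraph

end Ends

/-- Left translations are isometries, so the exceptional set found for balls about `1` serves every
centre `o`, and `r'` depends on `r` alone. -/
theorem IsOneEnded.exists_radius {H : Type*} [Group H] (hH : IsOneEnded H) :
    Infinite H ∧ ∃ S : Set H, IsFiniteGeneratingSet S ∧ ∀ r : ℕ, ∃ r' : ℕ, ∀ (o : H) (s : H → Prop),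
      (∀ h k, (mulCayley S).Adj h k → r < (mulCayley S).dist o h → r < (mulCayley S).dist o k →
        (s h ↔ s k)) →
      ∀ h k, r' < (mulCayley S).dist o h → r' < (mulCayley S).dist o k → (s h ↔ s k) := by
  obtain ⟨S, hS, hcard⟩ := hH
  have hend := Nat.card_eq_one_iff_unique.1 hcard
  have hc := mulCayley_connected hS.2
  refine ⟨?_, S, hS, fun r => ?_⟩
  · by_contra hinf
    have := not_infinite_iff_finite.1 hinf
    have := Fintype.ofFinite H
    obtain ⟨⟨s, -⟩⟩ := hend.2
    obtain ⟨v, h⟩ := (s (Opposite.op Finset.univ)).nonempty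
    exact h.1 (by simp)
  · have : LocallyFinite (mulCayley S) := fun g => ((hS.finite_ball g 1).subset
      fun h hh => (dist_eq_one_iff_adj.2 hh).le).fintype
    obtain ⟨L, hL, hLs⟩ := exists_finite_of_subsingleton_end hc.preconnected hend.1
      (hS.finite_ball 1 r).toFinset
    obtain ⟨r', hr'⟩ := (hL.image fun h => (mulCayley S).dist 1 h).bddAbove
    refine ⟨r', fun o s hs h k hh hk => ?_⟩
    have hd : ∀ x, (mulCayley S).dist o (o * x) = (mulCayley S).dist 1 x := fun x => by
      rw [mulCayley_dist_eq hS.2, inv_mul_cancel_left]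
    have hd' : ∀ x, (mulCayley S).dist 1 (o⁻¹ * x) = (mulCayley S).dist o x := fun x =>
      (mulCayley_dist_eq hS.2 _ _).symm
    have := hLs (fun x => s (o * x)) (fun p q hpq hp hq => hs _ _
      (mulCayley_adj_mul_iff_right.2 hpq) (by simpa [hd] using hp) (by simpa [hd] using hq))
      (o⁻¹ * h) (o⁻¹ * k) (fun hL' => ?_) (fun hL' => ?_)
    · simpa using this
    · exact absurd (hr' ⟨_, hL', rfl⟩) (by simpa [hd'] using hh)
    · exact absurd (hr' ⟨_, hL', rfl⟩) (by simpa [hd'] using hk)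

/-! ### The universal property of the fundamental group -/

namespace GraphOfGroups

variable {V : Type u₁} {E : Type u₂} {𝒢 : GraphOfGroups.{u₁, u₂, u₃, u₄} V E} {T : Set E}

theorem Joined.mono {T T' : Set E} (h : T ⊆ T') {v w : V} (hvw : 𝒢.Joined T v w) :
    𝒢.Joined T' v w :=
  Relation.EqvGen.mono (fun _ _ ⟨e, he, h'⟩ => ⟨e, h he, h'⟩) _ _ hvw

/-- A family of group elements on the edges is the coboundary, along a spanning tree, of a family
of group elements on the vertices. -/
theorem IsSpanningTree.exists_potential [Finite E] (hT : 𝒢.IsSpanningTree T) {Γ : Type*} [Group Γ]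
    (σ : E → Γ) : ∃ τ : V → Γ, ∀ e ∈ T, τ (𝒢.src e) * σ e = τ (𝒢.tgt e) := by
  classical
  have key : ∀ T' : Set E, T'.Finite → T' ⊆ T →
      ∃ τ : V → Γ, ∀ e ∈ T', τ (𝒢.src e) * σ e = τ (𝒢.tgt e) := by
    intro T' hfin
    induction T', hfin using Set.Finite.induction_on with
    | empty => exact fun _ => ⟨fun _ => 1, fun e he => he.elim⟩
    | @insert e T' he _ ih =>
      intro hsub
      obtain ⟨τ, hτ⟩ := ih ((Set.subset_insert _ _).trans hsub)
      -- The new edge joins two different components. Left multiplication on the whole component of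
      -- `tgt e` corrects `τ` along `e` and preserves the relations already obtained.
      have hsep : ¬ 𝒢.Joined T' (𝒢.src e) (𝒢.tgt e) := fun h =>
        hT.isBridge e (hsub (Set.mem_insert _ _)) (Joined.mono (T' := T \ {e}) (fun x hx =>
          ⟨hsub (Set.mem_insert_of_mem _ hx), fun hxe => he (hxe ▸ hx)⟩) h)
      refine ⟨fun v => if 𝒢.Joined T' v (𝒢.tgt e) then
        τ (𝒢.src e) * σ e * (τ (𝒢.tgt e))⁻¹ * τ v else τ v, fun e' he' => ?_⟩
      obtain rfl | he' := he'
      · simp [if_neg hsep, show 𝒢.Joined T' (𝒢.tgt e') (𝒢.tgt e') from Relation.EqvGen.refl _]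
      · have hj : 𝒢.Joined T' (𝒢.src e') (𝒢.tgt e') := Relation.EqvGen.rel _ _ ⟨e', he', rfl, rfl⟩
        have hiff : 𝒢.Joined T' (𝒢.src e') (𝒢.tgt e) ↔ 𝒢.Joined T' (𝒢.tgt e') (𝒢.tgt e) :=
          ⟨fun h => (Relation.EqvGen.symm _ _ hj).trans _ _ _ h, fun h => hj.trans _ _ _ h⟩
        by_cases h : 𝒢.Joined T' (𝒢.tgt e') (𝒢.tgt e)
        · simp only [if_pos h, if_pos (hiff.2 h), mul_assoc, hτ e' he']
        · simp only [if_neg h, if_neg (mt hiff.1 h), hτ e' he']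
  exact key T (Set.toFinite T) subset_rfl

variable {G : Type u₉} [Group G] (φ : 𝒢.FundamentalGroup T ≃* G)

/-- The projection of the free product to a group that is identified with the fundamental group. -/
def proj : 𝒢.FreeProduct →* G :=
  φ.toMonoidHom.comp (QuotientGroup.mk' (Subgroup.normalClosure (𝒢.relators T)))

theorem proj_surjective : Function.Surjective (proj φ) :=
  φ.surjective.comp (QuotientGroup.mk'_surjective _)

theorem proj_eq_one {x : 𝒢.FreeProduct} (hx : x ∈ 𝒢.relators T) : proj φ x = 1 := by
  have h : QuotientGroup.mk' (Subgroup.normalClosure (𝒢.relators T)) x = 1 :=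
    (QuotientGroup.eq_one_iff _).2 (Subgroup.subset_normalClosure hx)
  exact (congrArg φ h).trans φ.map_one

theorem exists_comp_proj_eq {Γ : Type*} [Group Γ] (F : 𝒢.FreeProduct →* Γ)
    (hF : ∀ x ∈ 𝒢.relators T, F x = 1) : ∃ Ψ : G →* Γ, ∀ x, Ψ (proj φ x) = F x := by
  let Ψ : 𝒢.FundamentalGroup T →* Γ :=
    QuotientGroup.lift _ F (Subgroup.normalClosure_le_normal (N := F.ker) hF)
  refine ⟨Ψ.comp φ.symm.toMonoidHom, fun x => ?_⟩
  exact congrArg Ψ (φ.symm_apply_apply _)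

/-- The canonical homomorphism of a vertex group to a group that is identified with the fundamental
group. -/
def incl (v : V) : 𝒢.vertexGroup v →* G :=
  (proj φ).comp (𝒢.ofVertex v)

/-- The stable letter of an edge, as an element of a group that is identified with the fundamental
group. -/
def stable (e : E) : G :=
  proj φ (𝒢.stableLetter e)

theorem stable_mul_incl (e : E) (a : 𝒢.edgeGroup e) :
    stable φ e * incl φ (𝒢.tgt e) (𝒢.tgtHom e a) = incl φ (𝒢.src e) (𝒢.srcHom e a) * stable φ e := by
  have h := proj_eq_one φ (Or.inl ⟨e, a, rfl⟩)
  simp only [map_mul, map_inv] at h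
  exact mul_inv_eq_iff_eq_mul.1 (mul_inv_eq_one.1 h)

theorem stable_eq_one {e : E} (he : e ∈ T) : stable φ e = 1 :=
  proj_eq_one φ (Or.inr ⟨e, he, rfl⟩)

theorem eq_top_of_incl_of_stable {K : Subgroup G} (hv : ∀ v x, incl φ v x ∈ K)
    (he : ∀ e, stable φ e ∈ K) : K = ⊤ := by
  have key : ∀ x : 𝒢.FreeProduct, proj φ x ∈ K := by
    intro x
    induction x using Monoid.Coprod.induction_on with
    | inl m =>
      induction m using Monoid.CoprodI.induction_on with
      | one => simp
      | of v x => exact hv v x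
      | mul x y hx hy => simpa using K.mul_mem hx hy
    | inr n =>
      induction n using FreeGroup.induction_on with
      | C1 => simp
      | of e => exact he e
      | inv_of e h => simpa using K.inv_mem h
      | mul x y hx hy => simpa using K.mul_mem hx hy
    | mul x y hx hy => simpa using K.mul_mem hx hy
  rw [Subgroup.eq_top_iff']
  intro g
  obtain ⟨x, rfl⟩ := proj_surjective φ g
  exact key x

/-- Conjugate representations of the vertex groups, and elements intertwining the two
restrictions to each edge group, define a representation of the fundamental group. -/
theorem exists_lift {Γ : Type*} [Group Γ] (ρ : ∀ v, 𝒢.vertexGroup v →* Γ) (σ : E → Γ) (τ : V → Γ)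
    (hσ : ∀ e a, σ e * ρ (𝒢.tgt e) (𝒢.tgtHom e a) = ρ (𝒢.src e) (𝒢.srcHom e a) * σ e)
    (hτ : ∀ e ∈ T, τ (𝒢.src e) * σ e = τ (𝒢.tgt e)) :
    ∃ Ψ : G →* Γ, (∀ v x, Ψ (incl φ v x) = τ v * ρ v x * (τ v)⁻¹) ∧
      ∀ e, Ψ (stable φ e) = τ (𝒢.src e) * σ e * (τ (𝒢.tgt e))⁻¹ := by
  let F : 𝒢.FreeProduct →* Γ := Monoid.Coprod.lift
    (Monoid.CoprodI.lift fun v => (MulAut.conj (τ v)).toMonoidHom.comp (ρ v))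
    (FreeGroup.lift fun e => τ (𝒢.src e) * σ e * (τ (𝒢.tgt e))⁻¹)
  have hF : ∀ v x, F (𝒢.ofVertex v x) = τ v * ρ v x * (τ v)⁻¹ := fun v x => by
    simp [F, ofVertex]
  have hF' : ∀ e, F (𝒢.stableLetter e) = τ (𝒢.src e) * σ e * (τ (𝒢.tgt e))⁻¹ := fun e => by
    simp [F, stableLetter]
  obtain ⟨Ψ, hΨ⟩ := exists_comp_proj_eq φ F (by
    rintro x (⟨e, a, rfl⟩ | ⟨e, he, rfl⟩)
    · have h := hσ e a
      rw [← mul_inv_eq_iff_eq_mul] at h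
      simp only [map_mul, map_inv, hF, hF', ← h]
      group
    · simp [hF', hτ e he])
  exact ⟨Ψ, fun v x => (hΨ _).trans (hF v x), fun e => (hΨ _).trans (hF' e)⟩

/-! ### Injectivity of the vertex groups -/

/-- Both right actions of `C` on `Q` are free, and since `C` is finite and `Q` infinite each has as
many orbits as `Q` has elements. Match the orbits by a bijection `θ`, then match points by their
`C`-coordinates `α`, `β` relative to orbit representatives. -/
theorem exists_perm_conj {Q : Type*} [Group Q] [Infinite Q] {C : Type*} [Group C] [Finite C]
    (f g : C →* Q) (hf : Function.Injective f) (hg : Function.Injective g) :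
    ∃ σ : Equiv.Perm Q, ∀ a q, σ (q * (g a)) = σ q * f a := by
  have hcard : ∀ K : Subgroup Q, Finite K → Cardinal.mk (Q ⧸ K) = Cardinal.mk Q := by
    intro K hK
    have h := Cardinal.mk_congr (Subgroup.groupEquivQuotientProdSubgroup (s := K))
    have hinf : Infinite (Q ⧸ K) := by
      by_contra hfin
      have := not_infinite_iff_finite.1 hfin
      exact not_finite_iff_infinite.2 ‹Infinite Q›
        (Finite.of_equiv _ (Subgroup.groupEquivQuotientProdSubgroup (s := K)).symm)
    rw [h, Cardinal.mk_prod, Cardinal.lift_id, Cardinal.lift_id, Cardinal.mul_eq_left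
      (Cardinal.aleph0_le_mk _) ((Cardinal.lt_aleph0_of_finite K).le.trans
        (Cardinal.aleph0_le_mk _)) (Cardinal.mk_ne_zero _)]
  have hff : Finite f.range := Finite.of_surjective _ f.rangeRestrict_surjective
  have hgf : Finite g.range := Finite.of_surjective _ g.rangeRestrict_surjective
  obtain ⟨θ⟩ := Cardinal.eq.1 ((hcard g.range hgf).trans (hcard f.range hff).symm)
  have hout : ∀ (h : C →* Q) (q : Q), ∃ a, q = (q : Q ⧸ h.range).out * h a := fun h q => by
    obtain ⟨⟨_, a, rfl⟩, ha⟩ := QuotientGroup.mk_out_eq_mul h.range q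
    exact ⟨a⁻¹, by simp [ha]⟩
  have hmk : ∀ (h : C →* Q) (q : Q) (a : C), ((q * h a : Q) : Q ⧸ h.range) = q := fun h q a =>
    QuotientGroup.mk_mul_of_mem q ⟨a, rfl⟩
  choose α hα using hout g
  choose β hβ using hout f
  have hα' : ∀ x a, α ((x : Q ⧸ g.range).out * g a) = a := fun x a => by
    have := hα (x.out * g a)
    rw [hmk, QuotientGroup.out_eq', mul_right_inj] at this
    exact (hg this).symm
  have hβ' : ∀ x a, β ((x : Q ⧸ f.range).out * f a) = a := fun x a => by
    have := hβ (x.out * f a)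
    rw [hmk, QuotientGroup.out_eq', mul_right_inj] at this
    exact (hf this).symm
  refine ⟨⟨fun q => (θ q).out * f (α q), fun q => (θ.symm q).out * g (β q), fun q => ?_,
    fun q => ?_⟩, fun a q => ?_⟩
  · simp only [hmk, QuotientGroup.out_eq', hβ', Equiv.symm_apply_apply]
    exact (hα q).symm
  · simp only [hmk, QuotientGroup.out_eq', hα', Equiv.apply_symm_apply]
    exact (hβ q).symm
  · have h : α (q * g a) = α q * a := by
      conv_lhs => rw [hα q, mul_assoc, ← map_mul, hα']
    simp only [Equiv.coe_fn_mk, hmk, h, map_mul, mul_assoc]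

theorem incl_injective [Finite E] [∀ e, Finite (𝒢.edgeGroup e)] (hT : 𝒢.IsSpanningTree T) (v : V) :
    Function.Injective (incl φ v) := by
  classical
  -- A group containing every vertex group; the factor `ℤ` makes it infinite. Its regular
  -- representation restricts to conjugate representations of each edge group, so these glue to a
  -- representation that is faithful on vertex groups.
  let Q := (∀ v, 𝒢.vertexGroup v) × Multiplicative ℤ
  let j : ∀ v, 𝒢.vertexGroup v →* Q := fun v =>
    (MonoidHom.inl _ _).comp (MonoidHom.mulSingle 𝒢.vertexGroup v)
  have hj : ∀ v, Function.Injective (j v) := fun v x y h =>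
    Pi.mulSingle_injective (M := 𝒢.vertexGroup) v (congrArg Prod.fst h)
  let R : Q →* Equiv.Perm Q :=
    { toFun := fun q => Equiv.mulRight q⁻¹
      map_one' := by ext1; simp
      map_mul' := fun a b => by ext1; simp [mul_assoc] }
  choose σ hσ using fun e => exists_perm_conj ((j _).comp (𝒢.srcHom e)) ((j _).comp (𝒢.tgtHom e))
    ((hj _).comp (𝒢.srcHom_injective e)) ((hj _).comp (𝒢.tgtHom_injective e))
  obtain ⟨τ, hτ⟩ := hT.exists_potential σ
  obtain ⟨Ψ, hΨ, -⟩ := exists_lift φ (fun v => R.comp (j v)) σ τ (fun e a => by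
    ext1 q
    have := hσ e a⁻¹ q
    simpa [R] using this) hτ
  intro x y hxy
  have h := congrArg Ψ hxy
  rw [hΨ, hΨ, mul_left_inj, mul_right_inj] at h
  have h1 := congrArg (fun p : Equiv.Perm Q => p 1) h
  simp only [R, MonoidHom.comp_apply, MonoidHom.coe_mk, OneHom.coe_mk, Equiv.coe_mulRight,
    one_mul] at h1
  exact hj v (inv_injective h1)

end GraphOfGroups

/-! ### The Bass-Serre graph -/

namespace GraphOfGroups

variable {V : Type u₁} {E : Type u₂} {𝒢 : GraphOfGroups.{u₁, u₂, u₃, u₄} V E} {T : Set E}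
variable {G : Type u₉} [Group G] (φ : 𝒢.FundamentalGroup T ≃* G)

/-- The image of an edge group, embedded in the vertex group at its source. -/
def edgeSubgroup (e : E) : Subgroup G :=
  ((incl φ (𝒢.src e)).comp (𝒢.srcHom e)).range

/-- The edges of the Bass-Serre graph: pairs of an edge and a left coset of its edge group. -/
abbrev Wall : Type _ :=
  Σ e : E, G ⧸ edgeSubgroup φ e

/-- The vertex space of type `v` through a group element. -/
def base (v : V) (g : G) : 𝒢.VertexSpaceIndex φ :=
  ⟨v, (g : G ⧸ 𝒢.vertexSubgroup φ v)⟩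

/-- The wall of type `e` through a group element. -/
def wall (e : E) (g : G) : Wall φ :=
  ⟨e, (g : G ⧸ edgeSubgroup φ e)⟩

theorem exists_base_eq (X : 𝒢.VertexSpaceIndex φ) : ∃ v g, base φ v g = X := by
  obtain ⟨v, X⟩ := X
  induction X using QuotientGroup.induction_on with
  | H g => exact ⟨v, g, rfl⟩

theorem exists_wall_eq (w : Wall φ) : ∃ e g, wall φ e g = w := by
  obtain ⟨v, X⟩ := w
  induction X using QuotientGroup.induction_on with
  | H g => exact ⟨v, g, rfl⟩

theorem base_eq_iff {v : V} {g h : G} : base φ v g = base φ v h ↔ ∃ x, h = g * incl φ v x := by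
  simp only [base, Sigma.mk.injEq, heq_eq_eq, true_and, QuotientGroup.eq]
  exact ⟨fun ⟨x, hx⟩ => ⟨x, eq_mul_of_inv_mul_eq hx.symm⟩, fun ⟨x, hx⟩ => ⟨x, by
    rw [hx]; exact (inv_mul_cancel_left _ _).symm⟩⟩

theorem mem_vertexSpace_iff {v : V} {g x : G} :
    x ∈ 𝒢.vertexSpace φ (base φ v g) ↔ base φ v x = base φ v g := by
  simp [vertexSpace, base]

theorem smul_base (k : G) (v : V) (g : G) : k • base φ v g = base φ v (k * g) := rfl

theorem smul_wall (k : G) (e : E) (g : G) : k • wall φ e g = wall φ e (k * g) := rfl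

theorem wall_mul (e : E) (g : G) (a : 𝒢.edgeGroup e) :
    wall φ e (g * incl φ (𝒢.src e) (𝒢.srcHom e a)) = wall φ e g := by
  simp only [wall, Sigma.mk.injEq, heq_eq_eq, true_and]
  exact QuotientGroup.mk_mul_of_mem g ⟨a, rfl⟩

/-- The source of an edge of the Bass-Serre graph. -/
def wallSrc (w : Wall φ) : 𝒢.VertexSpaceIndex φ :=
  ⟨𝒢.src w.1, Quotient.liftOn' w.2 (fun g => (g : G ⧸ 𝒢.vertexSubgroup φ (𝒢.src w.1)))
    (fun g h hgh => QuotientGroup.eq.2 (by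
      obtain ⟨a, ha⟩ := QuotientGroup.leftRel_apply.1 hgh
      exact ⟨_, ha⟩))⟩

/-- The target of an edge of the Bass-Serre graph. -/
def wallTgt (w : Wall φ) : 𝒢.VertexSpaceIndex φ :=
  ⟨𝒢.tgt w.1, Quotient.liftOn' w.2
    (fun g => ((g * stable φ w.1 : G) : G ⧸ 𝒢.vertexSubgroup φ (𝒢.tgt w.1)))
    (fun g h hgh => QuotientGroup.eq.2 (by
      obtain ⟨a, ha⟩ := QuotientGroup.leftRel_apply.1 hgh
      refine ⟨𝒢.tgtHom w.1 a, ?_⟩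
      change incl φ _ _ = _
      rw [mul_inv_rev, mul_assoc, ← mul_assoc g⁻¹, ← ha, eq_inv_mul_iff_mul_eq]
      exact stable_mul_incl φ w.1 a))⟩

theorem wallSrc_wall (e : E) (g : G) : wallSrc φ (wall φ e g) = base φ (𝒢.src e) g := rfl

theorem wallTgt_wall (e : E) (g : G) :
    wallTgt φ (wall φ e g) = base φ (𝒢.tgt e) (g * stable φ e) := rfl

theorem wallSrc_smul (k : G) (w : Wall φ) : wallSrc φ (k • w) = k • wallSrc φ w := by
  obtain ⟨e, g, rfl⟩ := exists_wall_eq φ w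
  rfl

theorem wallTgt_smul (k : G) (w : Wall φ) : wallTgt φ (k • w) = k • wallTgt φ w := by
  obtain ⟨e, g, rfl⟩ := exists_wall_eq φ w
  rw [smul_wall, wallTgt_wall, wallTgt_wall, smul_base, mul_assoc]

/-- Every edge of the Bass-Serre graph separates it: there is a map to the set of sets of edges
whose values at the two ends of an edge `w` differ precisely by `w`. -/
theorem exists_side [Finite E] (hT : 𝒢.IsSpanningTree T) :
    ∃ side : 𝒢.VertexSpaceIndex φ → Set (Wall φ),
      ∀ w, side (wallTgt φ w) = side (wallSrc φ w) ∆ {w} := by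
  -- Sets of walls form a vector space over the field with two elements. The plan is an affine
  -- action `Ψ` of `G` on it, with linear part the permutation of walls, in which crossing an edge
  -- adds that edge.
  let shift : Set (Wall φ) → Equiv.Perm (Set (Wall φ)) := fun m =>
    ⟨fun x => x ∆ m, fun x => x ∆ m, fun x => symmDiff_symmDiff_cancel_right m x,
      fun x => symmDiff_symmDiff_cancel_right m x⟩
  have shift_apply : ∀ m x, shift m x = x ∆ m := fun _ _ => rfl
  have hpi : ∀ (θ : Equiv.Perm (Set (Wall φ))) x, θ (θ⁻¹ x) = x := fun θ => θ.apply_symm_apply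
  have hpi' : ∀ (θ : Equiv.Perm (Set (Wall φ))) x, θ⁻¹ (θ x) = x := fun θ => θ.symm_apply_apply
  let Λ : Subgroup (Equiv.Perm (Set (Wall φ))) :=
    { carrier := {θ | ∀ x y : Set (Wall φ), θ (x ∆ y) = θ x ∆ y}
      one_mem' := fun x y => rfl
      mul_mem' := fun {θ θ'} h h' x y => by simp [h' x y, h _ y]
      inv_mem' := fun {θ} h x y => by
        rw [Equiv.Perm.inv_eq_iff_eq, h, hpi] }
  let σ₀ : E → Λ := fun e => ⟨shift {wall φ e 1}, fun x y => by
    simp only [shift_apply]; rw [symmDiff_right_comm]⟩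
  obtain ⟨τ, hτ⟩ := hT.exists_potential σ₀
  let L : G →* Equiv.Perm (Set (Wall φ)) := MulAction.toPermHom G (Set (Wall φ))
  -- The edge `e` gets the linear action of its stable letter followed by translation by `wall φ e
  -- 1`. The intertwining relation holds because the edge group fixes this wall.
  have L_apply : ∀ g x, L g x = g • x := fun _ _ => rfl
  obtain ⟨Ψ, hΨ, hΨ'⟩ := exists_lift φ (fun v => L.comp (incl φ v))
    (fun e => (σ₀ e).1 * L (stable φ e)) (fun v => (τ v).1)
    (fun e a => by
      have h := stable_mul_incl φ e a
      ext1 x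
      simp only [σ₀, MonoidHom.comp_apply, Equiv.Perm.mul_apply, L_apply, shift_apply, smul_smul,
        Set.smul_set_symmDiff, Set.smul_set_singleton, h]
      rw [smul_wall, mul_one, ← one_mul (incl φ _ _), wall_mul])
    (fun e he => by
      rw [stable_eq_one φ he, map_one, mul_one, ← hτ e he, Subgroup.coe_mul])
  have hτΛ : ∀ v (x y : Set (Wall φ)), (τ v).1 (x ∆ y) = (τ v).1 x ∆ y :=
    fun v => (τ v).2
  have hτinv : ∀ v (x y : Set (Wall φ)), (τ v).1⁻¹ (x ∆ y) = (τ v).1⁻¹ x ∆ y :=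
    fun v => (τ v)⁻¹.2
  let K : Subgroup G :=
    { carrier := {g | ∀ x y : Set (Wall φ), Ψ g (x ∆ y) = Ψ g x ∆ (g • y)}
      one_mem' := fun x y => by simp
      mul_mem' := fun {g g'} h h' x y => by simp [h' x y, h _ _, mul_smul]
      inv_mem' := fun {g} h x y => by
        rw [map_inv, Equiv.Perm.inv_eq_iff_eq, h, hpi, smul_inv_smul] }
  have hK : K = ⊤ := by
    refine eq_top_of_incl_of_stable φ (fun v g x y => ?_) (fun e x y => ?_)
    · simp only [hΨ, Equiv.Perm.mul_apply, hτinv, MonoidHom.comp_apply, L_apply,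
        Set.smul_set_symmDiff, hτΛ]
    · simp only [hΨ', Equiv.Perm.mul_apply, hτinv, L_apply, Set.smul_set_symmDiff, σ₀, shift_apply]
      rw [symmDiff_right_comm, hτΛ]
  have hΨK : ∀ g (x y : Set (Wall φ)), Ψ g (x ∆ y) = Ψ g x ∆ (g • y) := fun g => by
    have : g ∈ K := hK ▸ Subgroup.mem_top g
    exact this
  -- `τ v ∅` is fixed by `Ψ` on the vertex group at `v`, because `∅` is fixed by the linear action;
  -- so its translate by `g` depends only on the coset.
  refine ⟨fun X => Quotient.liftOn' X.2 (fun g => Ψ g ((τ X.1).1 ∅))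
    (fun g h hgh => ?_), fun w => ?_⟩
  · obtain ⟨x, hx⟩ := QuotientGroup.leftRel_apply.1 hgh
    have hx' : h = g * incl φ X.1 x := eq_mul_of_inv_mul_eq hx.symm
    simp [hx', hΨ, L_apply]
  · obtain ⟨e, g, rfl⟩ := exists_wall_eq φ w
    change Ψ (g * stable φ e) ((τ (𝒢.tgt e)).1 ∅) =
      Ψ g ((τ (𝒢.src e)).1 ∅) ∆ {wall φ e g}
    rw [map_mul, Equiv.Perm.mul_apply, hΨ']
    simp only [Equiv.Perm.mul_apply, hpi', L_apply, Set.smul_set_empty, σ₀,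
      shift_apply, hτΛ, hΨK, Set.smul_set_singleton, smul_wall, mul_one]

/-- Two vertex spaces are adjacent in the Bass-Serre graph. -/
def bassSerreGraph : SimpleGraph (𝒢.VertexSpaceIndex φ) :=
  SimpleGraph.fromRel fun X Y => ∃ w, wallSrc φ w = X ∧ wallTgt φ w = Y

theorem bassSerreGraph_connected (hT : 𝒢.IsSpanningTree T) : (bassSerreGraph φ).Connected := by
  have hstep : ∀ w, (bassSerreGraph φ).Reachable (wallSrc φ w) (wallTgt φ w) := by
    intro w
    by_cases h : wallSrc φ w = wallTgt φ w
    · rw [h]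
    · exact SimpleGraph.Adj.reachable ⟨h, Or.inl ⟨w, rfl, rfl⟩⟩
  have htree : ∀ v w g, (bassSerreGraph φ).Reachable (base φ v g) (base φ w g) := by
    intro v w g
    have h := hT.connected v w
    induction h with
    | rel v w h =>
      obtain ⟨e, he, rfl, rfl⟩ := h
      simpa [wallSrc_wall, wallTgt_wall, stable_eq_one φ he] using hstep (wall φ e g)
    | refl => rfl
    | symm _ _ _ h => exact h.symm
    | trans _ _ _ _ _ h h' => exact h.trans h'
  obtain ⟨v₀⟩ := hT.nonempty
  -- The condition is imposed for all `g` at once, so it is closed under products and need only be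
  -- checked on generators.
  let K : Subgroup G :=
    { carrier := {k | ∀ g, (bassSerreGraph φ).Reachable (base φ v₀ g) (base φ v₀ (g * k))}
      one_mem' := fun g => by simp
      mul_mem' := fun {k k'} h h' g => by
        rw [← mul_assoc]
        exact (h g).trans (h' (g * k))
      inv_mem' := fun {k} h g => by simpa using (h (g * k⁻¹)).symm }
  have hK : K = ⊤ := by
    refine eq_top_of_incl_of_stable φ (fun v x g => ?_) (fun e g => ?_)
    · refine (htree v₀ v g).trans ?_
      rw [(base_eq_iff φ).2 ⟨x, rfl⟩]
      exact htree v v₀ _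
    · exact ((htree v₀ (𝒢.src e) g).trans (hstep (wall φ e g))).trans (htree _ v₀ _)
  refine { preconnected := fun X Y => ?_, nonempty := ⟨base φ v₀ 1⟩ }
  obtain ⟨v, g, rfl⟩ := exists_base_eq φ X
  obtain ⟨w, h, rfl⟩ := exists_base_eq φ Y
  have hgh : g⁻¹ * h ∈ K := hK ▸ Subgroup.mem_top _
  have := hgh g
  rw [mul_inv_cancel_left] at this
  exact ((htree v v₀ g).trans this).trans (htree v₀ w h)

end GraphOfGroups

/-! ### Trees and the partitions defined by their edges -/

/-- A tree with vertex set `P` and edge set `W`: a connected graph together with, for each edge, a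
partition of the vertex set into two sides that is crossed by this edge only. -/
structure EdgeTree (P W : Type*) where
  src : W → P
  tgt : W → P
  side : P → Set W
  side_tgt : ∀ w, side (tgt w) = side (src w) ∆ {w}
  connected : (SimpleGraph.fromRel fun X Y => ∃ w, src w = X ∧ tgt w = Y).Connected

namespace EdgeTree

variable {P W : Type*} (D : EdgeTree P W)

/-- The edge `w` separates the vertices `X` and `Y`. -/
def Separates (w : W) (X Y : P) : Prop :=
  ¬ (w ∈ D.side X ↔ w ∈ D.side Y)

/-- The vertex `X` is an end of the edge `w`. -/
def Incident (w : W) (X : P) : Prop :=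
  D.src w = X ∨ D.tgt w = X

/-- The underlying simple graph of the tree. -/
def graph : SimpleGraph P :=
  SimpleGraph.fromRel fun X Y => ∃ w, D.src w = X ∧ D.tgt w = Y

variable {D}

theorem separates_comm {w : W} {X Y : P} : D.Separates w X Y ↔ D.Separates w Y X := by
  unfold Separates; tauto

theorem Separates.or {w : W} {X Y : P} (h : D.Separates w X Y) (Z : P) :
    D.Separates w X Z ∨ D.Separates w Z Y := by
  unfold Separates at *; tauto

theorem not_separates_self (w : W) (X : P) : ¬ D.Separates w X X := fun h => h Iff.rfl

theorem separates_src_tgt {w w' : W} : D.Separates w (D.src w') (D.tgt w') ↔ w = w' := by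
  simp only [Separates, D.side_tgt, Set.mem_symmDiff, Set.mem_singleton_iff]
  tauto

theorem separates_of_incident {w : W} {X : P} (h : D.Incident w X) :
    ∃ X', ∀ w', D.Separates w' X X' ↔ w' = w := by
  obtain rfl | rfl := h
  · exact ⟨D.tgt w, fun w' => separates_src_tgt⟩
  · exact ⟨D.src w, fun w' => separates_comm.trans separates_src_tgt⟩

theorem Incident.separates_iff {w w' : W} {X : P} (h : D.Incident w' X) (hw : w ≠ w') (Y : P) :
    D.Separates w Y (D.src w') ↔ D.Separates w Y X := by
  obtain rfl | rfl := h
  · rfl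
  · have := mt (separates_src_tgt (D := D)).1 hw
    unfold Separates at *
    tauto

theorem exists_of_adj {X Y : P} (h : D.graph.Adj X Y) :
    ∃ w, D.Incident w X ∧ s(D.src w, D.tgt w) = s(X, Y) ∧ ∀ w', D.Separates w' X Y ↔ w' = w := by
  obtain ⟨-, ⟨w, rfl, rfl⟩ | ⟨w, rfl, rfl⟩⟩ := h
  · exact ⟨w, Or.inl rfl, rfl, fun w' => separates_src_tgt⟩
  · exact ⟨w, Or.inr rfl, Sym2.eq_swap, fun w' => separates_comm.trans separates_src_tgt⟩

theorem edge_injective {w w' : W} (h : s(D.src w, D.tgt w) = s(D.src w', D.tgt w')) : w = w' := by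
  rw [← separates_src_tgt (D := D)]
  obtain ⟨h1, h2⟩ | ⟨h1, h2⟩ := Sym2.eq_iff.1 h
  · rw [← h1, ← h2, separates_src_tgt]
  · rw [← h1, ← h2, separates_comm, separates_src_tgt]

/-- Each step of the walk flips membership of exactly the edge crossed, and a trail crosses no edge
twice. -/
theorem separates_iff_mem_edges {X Y : P} (p : D.graph.Walk X Y) (hp : p.IsTrail) (w : W) :
    D.Separates w X Y ↔ s(D.src w, D.tgt w) ∈ p.edges := by
  induction p with
  | nil => simp [not_separates_self]
  | @cons X X' Y h p ih =>
    rw [SimpleGraph.Walk.isTrail_cons] at hp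
    obtain ⟨w', -, hw', hsep⟩ := exists_of_adj h
    have ih := ih hp.1
    rw [SimpleGraph.Walk.edges_cons, List.mem_cons]
    by_cases hww : w = w'
    · subst hww
      have h1 := (hsep w).2 rfl
      have h2 := mt ih.1 (hw' ▸ hp.2)
      refine iff_of_true ?_ (Or.inl hw')
      unfold Separates at *
      tauto
    · have h1 := mt (hsep w).1 hww
      have h2 : s(D.src w, D.tgt w) ≠ s(X, X') := fun h => hww (edge_injective (h.trans hw'.symm))
      rw [or_iff_right h2, ← ih]
      unfold Separates at *
      tauto

theorem exists_path (X Y : P) : ∃ p : D.graph.Walk X Y, p.IsPath :=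
  (D.connected.preconnected X Y).exists_isPath

theorem finite_separates (X Y : P) : {w | D.Separates w X Y}.Finite := by
  obtain ⟨p, hp⟩ := exists_path (D := D) X Y
  refine Set.Finite.of_finite_image (f := fun w => s(D.src w, D.tgt w)) ?_
    fun w _ w' _ h => edge_injective h
  refine p.edges.finite_toSet.subset ?_
  rintro _ ⟨w, hw, rfl⟩
  exact (separates_iff_mem_edges p hp.isTrail w).1 hw

theorem exists_incident {X Y : P} (h : X ≠ Y) : ∃ w, D.Incident w X ∧ D.Separates w X Y := by
  obtain ⟨p, hp⟩ := exists_path (D := D) X Y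
  cases p with
  | nil => exact absurd rfl h
  | cons hX p =>
    obtain ⟨w, hw, hw', -⟩ := exists_of_adj hX
    exact ⟨w, hw, (separates_iff_mem_edges _ hp.isTrail w).2 (by simp [hw'])⟩

/-- An edge with an end on one side of the edge `w` does not separate vertices on the other side
of `w`. -/
theorem not_separates_of_separates {w w' : W} {Y Y' : P} (hY : D.Separates w Y (D.src w'))
    (hw : ¬ D.Separates w Y Y') : ¬ D.Separates w' Y Y' := by
  classical
  intro h
  obtain ⟨p, hp⟩ := exists_path (D := D) Y Y'
  rw [separates_iff_mem_edges p hp.isTrail] at h hw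
  have hs := p.fst_mem_support_of_mem_edges h
  rw [separates_iff_mem_edges (p.takeUntil _ hs) (hp.takeUntil hs).isTrail] at hY
  exact hw (p.edges_takeUntil_subset_edges hs hY)

/-- After crossing `w` from `X`, one is on the same side of `w` as `Z`, where the other edge `w'`
can no longer separate anything. So only one edge at `X` leads towards `Z`. -/
theorem Incident.eq_of_separates {w w' : W} {X Z : P} (hw : D.Incident w X) (hw' : D.Incident w' X)
    (h : D.Separates w X Z) (h' : D.Separates w' X Z) : w = w' := by
  by_contra hne
  obtain ⟨X', hX'⟩ := separates_of_incident hw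
  have h1 := (hX' w).2 rfl
  have h2 := mt (hX' w').1 (Ne.symm hne)
  have h3 := not_separates_of_separates (w := w) (w' := w') (Y := Z) (Y' := X')
    ((hw'.separates_iff hne Z).2 (separates_comm.1 h)) (by unfold Separates at *; tauto)
  unfold Separates at *
  tauto

/-- A choice of a side of each edge is given by a vertex, if any two of the chosen sides meet and all
but finitely many of them contain some fixed vertex. -/
theorem exists_forall_mem_side_iff (b : W → Prop)
    (hb : ∀ w w', ∃ Z, (w ∈ D.side Z ↔ b w) ∧ (w' ∈ D.side Z ↔ b w'))
    {X₀ : P} (hX₀ : {w | ¬ (w ∈ D.side X₀ ↔ b w)}.Finite) :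
    ∃ X, ∀ w, w ∈ D.side X ↔ b w := by
  let N : P → Set W := fun X => {w | ¬ (w ∈ D.side X ↔ b w)}
  have hfin : ∀ X, (N X).Finite := fun X => by
    refine (hX₀.union (finite_separates (D := D) X X₀)).subset fun w hw => ?_
    simp only [N, Set.mem_union, Set.mem_ofPred_eq, Separates] at hw ⊢
    tauto
  -- Take `X` violating the fewest choices. If `w` is still violated, the first edge `w₁` from `X`
  -- towards the chosen side of `w` must be correct at `X`, as crossing it would otherwise reduce
  -- the count. Then the chosen sides of `w` and `w₁` are disjoint, contrary to `hb`.
  obtain ⟨X, hX⟩ : ∃ X, ∀ Y, (N X).ncard ≤ (N Y).ncard := by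
    obtain ⟨_, ⟨X, rfl⟩, hX⟩ := WellFounded.has_min (wellFounded_lt (α := ℕ))
      (Set.range fun X => (N X).ncard) ⟨_, X₀, rfl⟩
    exact ⟨X, fun Y => not_lt.1 (hX _ ⟨Y, rfl⟩)⟩
  refine ⟨X, fun w => ?_⟩
  by_contra hw
  obtain ⟨Z, hZ, -⟩ := hb w w
  have hwZ : D.Separates w X Z := by unfold Separates; tauto
  have hXZ : X ≠ Z := by rintro rfl; exact not_separates_self _ _ hwZ
  obtain ⟨w₁, hw₁, hsep⟩ := exists_incident (D := D) hXZ
  obtain ⟨X₁, hX₁⟩ := separates_of_incident hw₁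
  have hgood : w₁ ∈ D.side X ↔ b w₁ := by
    by_contra hbad
    have hlt : (N X₁).ncard < (N X).ncard := by
      refine Set.ncard_lt_ncard ⟨fun x hx => ?_, fun hsub => ?_⟩ (hfin X)
      · have h1 := hX₁ x
        by_cases hxw : x = w₁
        · subst hxw; exact hbad
        · have h1 := mt (hX₁ x).1 hxw
          simp only [N, Set.mem_ofPred_eq, Separates] at hx h1 ⊢
          tauto
      · have h1 := (hX₁ w₁).2 rfl
        have h2 : w₁ ∈ N X₁ := hsub hbad
        simp only [N, Set.mem_ofPred_eq, Separates] at h1 h2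
        tauto
    exact absurd (hX X₁) (not_le.2 hlt)
  have hne : w ≠ w₁ := by rintro rfl; exact hw hgood
  obtain ⟨Z', hZ', hZ₁'⟩ := hb w w₁
  have h3 := not_separates_of_separates (w := w) (w' := w₁) (Y := Z) (Y' := Z')
    ((hw₁.separates_iff hne Z).2 (separates_comm.1 hwZ)) (by unfold Separates; tauto)
  unfold Separates at h3 hsep
  tauto

end EdgeTree

namespace GraphOfGroups

variable {V : Type u₁} {E : Type u₂} {𝒢 : GraphOfGroups.{u₁, u₂, u₃, u₄} V E} {T : Set E}
variable {G : Type u₉} [Group G] (φ : 𝒢.FundamentalGroup T ≃* G)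

/-- The Bass-Serre tree. -/
noncomputable def bassSerreTree [Finite E] (hT : 𝒢.IsSpanningTree T) :
    EdgeTree (𝒢.VertexSpaceIndex φ) (Wall φ) where
  src := wallSrc φ
  tgt := wallTgt φ
  side := (exists_side φ hT).choose
  side_tgt := (exists_side φ hT).choose_spec
  connected := bassSerreGraph_connected φ hT

end GraphOfGroups

/-! ### Geometry of the vertex spaces -/

namespace GraphOfGroups

variable {V : Type u₁} {E : Type u₂} {𝒢 : GraphOfGroups.{u₁, u₂, u₃, u₄} V E} {T : Set E}
variable {G : Type u₉} [Group G] (φ : 𝒢.FundamentalGroup T ≃* G)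

/-- The edge `w` of the Bass-Serre tree passes within distance `n` of the group element `g`. -/
def IsNearWall (S : Set G) (n : ℕ) (g : G) (w : Wall φ) : Prop :=
  ∃ e c, wall φ e c = w ∧ (mulCayley S).dist g c ≤ n

variable {φ} {S : Set G}

theorem IsNearWall.of_dist_le (hS : IsFiniteGeneratingSet S) {n m k : ℕ} {g h : G} {w : Wall φ}
    (hw : IsNearWall φ S n g w) (hgh : (mulCayley S).dist h g ≤ m) (hk : m + n ≤ k) :
    IsNearWall φ S k h w := by
  obtain ⟨e, c, hc, hd⟩ := hw
  have := (mulCayley_connected hS.2).dist_triangle (u := h) (v := g) (w := c)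
  exact ⟨e, c, hc, by omega⟩

/-- A fixed path from `X` to `Y` crosses finitely many walls, and everything is equivariant under
`k`. -/
theorem exists_isNearWall_smul [Finite E] (hT : 𝒢.IsSpanningTree T) (hS : IsFiniteGeneratingSet S)
    (X Y : 𝒢.VertexSpaceIndex φ) : ∃ n, ∀ (k : G) w,
      (bassSerreTree φ hT).Separates w (k • X) (k • Y) → IsNearWall φ S n k w := by
  obtain ⟨p⟩ := (bassSerreGraph_connected φ hT).preconnected X Y
  induction p with
  | nil => exact ⟨0, fun k w h => absurd h (EdgeTree.not_separates_self _ _)⟩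
  | @cons X X' Y h p ih =>
    obtain ⟨n, hn⟩ := ih
    obtain ⟨-, h⟩ := h
    have key : ∃ w₀, ∀ (k : G) w, (bassSerreTree φ hT).Separates w (k • X) (k • X') → w = k • w₀ := by
      obtain ⟨w₀, rfl, rfl⟩ | ⟨w₀, rfl, rfl⟩ := h
      · refine ⟨w₀, fun k w hw => ?_⟩
        rw [← wallSrc_smul, ← wallTgt_smul] at hw
        exact EdgeTree.separates_src_tgt.1 hw
      · refine ⟨w₀, fun k w hw => ?_⟩
        rw [← wallSrc_smul, ← wallTgt_smul] at hw
        exact EdgeTree.separates_src_tgt.1 (EdgeTree.separates_comm.1 hw)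
    obtain ⟨w₀, hw₀⟩ := key
    obtain ⟨e, c, rfl⟩ := exists_wall_eq φ w₀
    refine ⟨max n ((mulCayley S).dist 1 c), fun k w hw => ?_⟩
    obtain hw | hw := hw.or (k • X')
    · refine ⟨e, k * c, (hw₀ k w hw).symm, ?_⟩
      rw [mulCayley_dist_eq hS.2, inv_mul_cancel_left]
      exact le_max_right _ _
    · exact (hn k w hw).of_dist_le hS (m := 0) (by simp) (by simp)

/-- Along a geodesic from `g` to `h` some Cayley edge crosses `w`. Up to translation there are
finitely many Cayley edges, whence a uniform bound. -/
theorem exists_isNearWall_base [Finite E] (hT : 𝒢.IsSpanningTree T) (hS : IsFiniteGeneratingSet S)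
    (v : V) : ∃ n, ∀ g h w, (bassSerreTree φ hT).Separates w (base φ v g) (base φ v h) →
      IsNearWall φ S ((mulCayley S).dist g h + n) g w := by
  choose n hn using fun s => exists_isNearWall_smul hT hS (base φ v 1) (base φ v s)
  obtain ⟨m, hm⟩ := ((hS.1.union hS.1.inv).image n).bddAbove
  refine ⟨m, fun g h w hw => ?_⟩
  obtain ⟨a, b, hab, hsep, hd⟩ := (mulCayley_connected hS.2).exists_adj_of_not_iff
    (s := fun g => w ∈ (bassSerreTree φ hT).side (base φ v g)) hw
  have h1 := hn (a⁻¹ * b) a w (by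
    rw [smul_base, smul_base, mul_one, mul_inv_cancel_left]
    exact hsep)
  have h2 : n (a⁻¹ * b) ≤ m := hm ⟨_, by
    simpa using ((mulCayley_adj S _ _).1 hab).2, rfl⟩
  exact h1.of_dist_le hS hd (by omega)

theorem exists_wall_diam [Finite E] [∀ e, Finite (𝒢.edgeGroup e)] (hS : IsFiniteGeneratingSet S) :
    ∃ n, ∀ e c c', wall φ e c = wall φ e c' → (mulCayley S).dist c c' ≤ n := by
  have hfin : (Set.range fun x : Σ e, 𝒢.edgeGroup e =>
      (mulCayley S).dist 1 (incl φ (𝒢.src x.1) (𝒢.srcHom x.1 x.2))).Finite := Set.finite_range _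
  obtain ⟨n, hn⟩ := hfin.bddAbove
  refine ⟨n, fun e c c' h => ?_⟩
  simp only [wall, Sigma.mk.injEq, heq_eq_eq, true_and] at h
  obtain ⟨a, ha⟩ := QuotientGroup.eq.1 h
  rw [mulCayley_dist_eq hS.2, ← ha]
  exact hn ⟨⟨e, a⟩, rfl⟩

theorem exists_mem_vertexSpace_of_incident [Finite E] (hT : 𝒢.IsSpanningTree T)
    (hS : IsFiniteGeneratingSet S) :
    ∃ n, ∀ e c X, (bassSerreTree φ hT).Incident (wall φ e c) X →
      ∃ x ∈ 𝒢.vertexSpace φ X, (mulCayley S).dist c x ≤ n := by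
  obtain ⟨n, hn⟩ := (Set.finite_range fun e => (mulCayley S).dist 1 (stable φ e)).bddAbove
  refine ⟨n, fun e c X h => ?_⟩
  obtain rfl | rfl := h
  · exact ⟨c, rfl, by simp⟩
  · refine ⟨c * stable φ e, rfl, ?_⟩
    rw [mulCayley_dist_eq hS.2, inv_mul_cancel_left]
    exact hn ⟨e, rfl⟩

theorem finite_isNearWall [Finite E] [∀ e, Finite (𝒢.edgeGroup e)] (hS : IsFiniteGeneratingSet S)
    (n : ℕ) (w : Wall φ) : {g | IsNearWall φ S n g w}.Finite := by
  obtain ⟨m, hm⟩ := exists_wall_diam (φ := φ) hS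
  obtain ⟨e, c, rfl⟩ := exists_wall_eq φ w
  refine (hS.finite_ball c (m + n)).subset ?_
  rintro g ⟨e', c', hc, hd⟩
  obtain rfl : e' = e := congrArg Sigma.fst hc
  have h1 := hm e' c c' hc.symm
  have h2 := (mulCayley_connected hS.2).dist_triangle (u := c) (v := c') (w := g)
  rw [SimpleGraph.dist_comm (u := c')] at h2
  exact show (mulCayley S).dist c g ≤ m + n by omega

/-- The coarse intersection of two different vertex spaces is finite. -/
theorem finite_near_vertexSpaces [Finite E] [∀ e, Finite (𝒢.edgeGroup e)]
    (hT : 𝒢.IsSpanningTree T) (hS : IsFiniteGeneratingSet S) {X Y : 𝒢.VertexSpaceIndex φ}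
    (hXY : X ≠ Y) (R : ℕ) :
    {g | (∃ x ∈ 𝒢.vertexSpace φ X, (mulCayley S).dist g x ≤ R) ∧
      ∃ y ∈ 𝒢.vertexSpace φ Y, (mulCayley S).dist g y ≤ R}.Finite := by
  obtain ⟨w, -, hw⟩ := EdgeTree.exists_incident (D := bassSerreTree φ hT) hXY
  obtain ⟨v, g₀, rfl⟩ := exists_base_eq φ X
  obtain ⟨v', g₁, rfl⟩ := exists_base_eq φ Y
  obtain ⟨n, hn⟩ := exists_isNearWall_base hT hS (φ := φ) v
  obtain ⟨n', hn'⟩ := exists_isNearWall_base hT hS (φ := φ) v'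
  obtain ⟨m, hm⟩ := exists_isNearWall_smul hT hS (base φ v 1) (base φ v' 1)
  refine (finite_isNearWall hS (R + n + n' + m) w).subset ?_
  rintro g ⟨⟨x, hx, hgx⟩, y, hy, hgy⟩
  rw [mem_vertexSpace_iff] at hx hy
  rw [← hx, ← hy] at hw
  -- In the chain `base φ v x`, `base φ v g`, `base φ v' g`, `base φ v' y` some consecutive pair is
  -- separated by `w`, and each pair forces `w` to pass near `g`.
  obtain hw | hw := hw.or (base φ v g)
  · exact (hn g x w (EdgeTree.separates_comm.1 hw)).of_dist_le hS (m := 0) (by simp) (by omega)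
  · obtain hw | hw := hw.or (base φ v' g)
    · exact (hm g w (by simpa only [smul_base, mul_one] using hw)).of_dist_le hS (m := 0)
        (by simp) (by omega)
    · exact (hn' g y w hw).of_dist_le hS (m := 0) (by simp) (by omega)

/-- One-endedness selects a side of every wall, and the vertex in all selected sides is the required
space. All constants are fixed before `f`. -/
theorem exists_vertexSpace_of_radius [Finite E] [∀ e, Finite (𝒢.edgeGroup e)]
    (hT : 𝒢.IsSpanningTree T) (hS : IsFiniteGeneratingSet S) {H : Type*} [Group H] [Infinite H]
    {S' : Set H} (hS' : IsFiniteGeneratingSet S')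
    (hend : ∀ r : ℕ, ∃ r' : ℕ, ∀ (o : H) (s : H → Prop),
      (∀ h k, (mulCayley S').Adj h k → r < (mulCayley S').dist o h → r < (mulCayley S').dist o k →
        (s h ↔ s k)) →
      ∀ h k, r' < (mulCayley S').dist o h → r' < (mulCayley S').dist o k → (s h ↔ s k)) (a : ℕ) :
    ∃ R : ℕ, ∀ f : H → G, IsCoarseEmbedding (mulCayley S') (mulCayley S) a f →
      ∃ X : 𝒢.VertexSpaceIndex φ,
        ∀ h, ∃ x ∈ 𝒢.vertexSpace φ X, (mulCayley S).dist (f h) x ≤ R := by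
  have hG := mulCayley_connected hS.2
  have hH := mulCayley_connected hS'.2
  obtain ⟨v⟩ := hT.nonempty
  obtain ⟨n, hn⟩ := exists_isNearWall_base hT hS (φ := φ) v
  obtain ⟨d, hd⟩ := exists_wall_diam (φ := φ) hS
  obtain ⟨i, hi⟩ := exists_mem_vertexSpace_of_incident hT hS (φ := φ)
  -- Images of adjacent points are at distance at most `2 * a`, so two crossings of one wall have
  -- images within `2 * (2 * a + n) + d`; the rest of the radius pulls this back to `H`.
  obtain ⟨r, hr⟩ := hend (a * (2 * (2 * a + n) + d) + a)
  -- A displacement by `u` moves any point of an `r`-ball out of that ball.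
  obtain ⟨u, hu⟩ := hS'.exists_far (Set.finite_singleton 1) (2 * r)
  have hu := hu 1 rfl
  refine ⟨a * (mulCayley S').dist 1 u + a + n + i, fun f hf => ?_⟩
  have hside : ∀ w, ∃ o b, ∀ h, r < (mulCayley S').dist o h →
      (w ∈ (bassSerreTree φ hT).side (base φ v (f h)) ↔ b) := by
    intro w
    have hcross : ∀ h k, (mulCayley S').Adj h k →
        (bassSerreTree φ hT).Separates w (base φ v (f h)) (base φ v (f k)) →
        IsNearWall φ S (2 * a + n) (f h) w := fun h k hk hw => by
      have h1 := (hf h k).1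
      rw [dist_eq_one_iff_adj.2 hk] at h1
      exact (hn _ _ w hw).of_dist_le hS (m := 0) (by simp) (by omega)
    by_cases hex : ∃ h k, (mulCayley S').Adj h k ∧
        (bassSerreTree φ hT).Separates w (base φ v (f h)) (base φ v (f k))
    · obtain ⟨o, k, hok, ho⟩ := hex
      obtain ⟨e, c, rfl, hc⟩ := hcross o k hok ho
      obtain ⟨g, hg⟩ := hS'.exists_far (Set.finite_singleton o) r
      refine ⟨o, _, fun h hh => hr o
        (fun h => wall φ e c ∈ (bassSerreTree φ hT).side (base φ v (f h))) ?_ h g hh (hg o rfl)⟩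
      intro p q hpq hp _
      by_contra hne
      obtain ⟨e', c', hc', hd'⟩ := hcross p q hpq hne
      obtain rfl : e' = e := congrArg Sigma.fst hc'
      have h1 := hd _ _ _ hc'
      have h2 := hG.dist_triangle (u := f p) (v := c') (w := f o)
      have h3 := hG.dist_triangle (u := c') (v := c) (w := f o)
      rw [SimpleGraph.dist_comm (u := c)] at h3
      have h4 := (hf o p).2
      rw [SimpleGraph.dist_comm (u := f o)] at h4
      have h5 := Nat.mul_le_mul_left a
        (show (mulCayley S).dist (f p) (f o) ≤ 2 * (2 * a + n) + d by omega)
      omega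
    · refine ⟨1, _, fun h _ => hH.iff_of_forall_adj
        (s := fun h => w ∈ (bassSerreTree φ hT).side (base φ v (f h))) ?_ h 1⟩
      intro p q hpq
      by_contra hne
      exact hex ⟨p, q, hpq, hne⟩
  choose o b hob using hside
  have htri : ∀ w h k, 2 * r < (mulCayley S').dist h k → ¬ r < (mulCayley S').dist (o w) h →
      r < (mulCayley S').dist (o w) k := fun w h k h1 h2 => by
    have := hH.dist_triangle (u := h) (v := o w) (w := k)
    rw [SimpleGraph.dist_comm (u := h) (v := o w)] at this
    omega
  obtain ⟨X, hX⟩ := EdgeTree.exists_forall_mem_side_iff (D := bassSerreTree φ hT) b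
    (fun w w' => by
      obtain ⟨h, hh⟩ := hS'.exists_far (Set.toFinite {o w, o w'}) r
      exact ⟨base φ v (f h), hob w h (hh _ (by simp)), hob w' h (hh _ (by simp))⟩)
    (X₀ := base φ v (f 1)) (by
      refine (EdgeTree.finite_separates (D := bassSerreTree φ hT) (base φ v (f 1))
        (base φ v (f u))).subset fun w hw hsep => hw (hsep.trans (hob w u ?_))
      exact htri w 1 u hu (mt (hob w 1) hw))
  refine ⟨X, fun h => ?_⟩
  by_cases hXh : X = base φ v (f h)
  · exact ⟨f h, by rw [hXh, mem_vertexSpace_iff], by simp⟩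
  · obtain ⟨w, hw, hsep⟩ := EdgeTree.exists_incident (D := bassSerreTree φ hT) hXh
    have hdist : (mulCayley S').dist h (h * u) = (mulCayley S').dist 1 u := by
      rw [mulCayley_dist_eq hS'.2, inv_mul_cancel_left]
    have hbh : ¬ (w ∈ (bassSerreTree φ hT).side (base φ v (f h)) ↔ b w) := fun h' =>
      hsep ((hX w).trans h'.symm)
    -- The point `f h` is on the wrong side of `w` and `f (h * u)` on the right one, so `w` passes
    -- near `f h`.
    have hbu := hob w (h * u) (htri w h (h * u) (hdist ▸ hu) (mt (hob w h) hbh))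
    obtain ⟨e, c, rfl, hc⟩ := hn (f h) (f (h * u)) w (fun h' => hbh (h'.trans hbu))
    obtain ⟨x, hx, hcx⟩ := hi e c X hw
    refine ⟨x, hx, ?_⟩
    have h1 := hG.dist_triangle (u := f h) (v := c) (w := x)
    have h2 := (hf h (h * u)).1
    rw [hdist] at h2
    omega

/-- One-endedness is given for one generating set; the identity of `H` is a coarse embedding between
any two word metrics. -/
theorem exists_vertexSpace_of_isOneEnded [Finite E] [∀ e, Finite (𝒢.edgeGroup e)]
    (hT : 𝒢.IsSpanningTree T) (hS : IsFiniteGeneratingSet S) {H : Type*} [Group H]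
    (hH : IsOneEnded H) {S' : Set H} (hS' : IsFiniteGeneratingSet S') (a : ℕ) :
    ∃ R : ℕ, ∀ f : H → G, IsCoarseEmbedding (mulCayley S') (mulCayley S) a f →
      ∃ X : 𝒢.VertexSpaceIndex φ,
        ∀ h, ∃ x ∈ 𝒢.vertexSpace φ X, (mulCayley S).dist (f h) x ≤ R := by
  obtain ⟨hinf, S₀, hS₀, hend⟩ := hH.exists_radius
  obtain ⟨c, hc⟩ := hS₀.exists_lipschitz hS' (MonoidHom.id H)
  obtain ⟨c', hc'⟩ := hS'.exists_lipschitz hS₀ (MonoidHom.id H)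
  have hid : IsCoarseEmbedding (mulCayley S₀) (mulCayley S') (c + c') id := fun p q => by
    have h1 := hc p q
    have h2 := hc' p q
    simp only [MonoidHom.id_apply, id] at *
    constructor <;> nlinarith
  obtain ⟨R, hR⟩ := exists_vertexSpace_of_radius hT hS (φ := φ) hS₀ hend ((c + c') * a + (c + c') + a)
  exact ⟨R, fun f hf => hR f (hf.comp hid)⟩

end GraphOfGroups

/-! ### Vertex groups are undistorted -/

namespace GraphOfGroups

variable {V : Type u₁} {E : Type u₂} {𝒢 : GraphOfGroups.{u₁, u₂, u₃, u₄} V E} {T : Set E}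
variable {G : Type u₉} [Group G] {φ : 𝒢.FundamentalGroup T ≃* G} {S : Set G}

/-- There is a coarse retraction of the group to each of its vertex groups. -/
theorem exists_coarse_retraction [Finite E] [∀ e, Finite (𝒢.edgeGroup e)]
    (hT : 𝒢.IsSpanningTree T) (hS : IsFiniteGeneratingSet S) (v : V) :
    ∃ M, ∃ r : G → 𝒢.vertexGroup v, (∀ x, r (incl φ v x) = x) ∧
      ∀ g h, (mulCayley S).Adj g h →
        (mulCayley S).dist (incl φ v (r g)) (incl φ v (r h)) ≤ M := by
  have hG := mulCayley_connected hS.2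
  obtain ⟨n, hn⟩ := exists_isNearWall_base hT hS (φ := φ) v
  obtain ⟨d, hd⟩ := exists_wall_diam (φ := φ) hS
  obtain ⟨i, hi⟩ := exists_mem_vertexSpace_of_incident hT hS (φ := φ)
  have hmem : ∀ g, base φ v 1 = base φ v g → ∃ x, incl φ v x = g := fun g hg => by
    obtain ⟨x, hx⟩ := (base_eq_iff φ).1 hg
    exact ⟨x, by rw [hx, one_mul]⟩
  have hq : ∀ w, ∃ y, (bassSerreTree φ hT).Incident w (base φ v 1) → ∀ e c, wall φ e c = w →
      (mulCayley S).dist c (incl φ v y) ≤ d + i := by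
    intro w
    by_cases hw : (bassSerreTree φ hT).Incident w (base φ v 1)
    · obtain ⟨e, c, rfl⟩ := exists_wall_eq φ w
      obtain ⟨x, hx, hcx⟩ := hi e c _ hw
      obtain ⟨y, rfl⟩ := hmem x ((mem_vertexSpace_iff φ).1 hx).symm
      refine ⟨y, fun _ e' c' hc' => ?_⟩
      obtain rfl : e' = e := congrArg Sigma.fst hc'
      have h1 := hd _ _ _ hc'
      have h2 := hG.dist_triangle (u := c') (v := c) (w := incl φ v y)
      omega
    · exact ⟨1, fun h => absurd h hw⟩
  -- `q w` is a point of the vertex group close to the incident wall `w`. The retraction sends `g`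
  -- outside the vertex group to `q` of the wall through which the tree path leaves towards `g`.
  choose q hq using hq
  have hr : ∀ g, ∃ y, incl φ v y = g ∨ ∃ w, (bassSerreTree φ hT).Incident w (base φ v 1) ∧
      (bassSerreTree φ hT).Separates w (base φ v 1) (base φ v g) ∧ y = q w := by
    intro g
    by_cases hg : base φ v 1 = base φ v g
    · obtain ⟨x, hx⟩ := hmem g hg
      exact ⟨x, Or.inl hx⟩
    · obtain ⟨w, hw, hsep⟩ := EdgeTree.exists_incident (D := bassSerreTree φ hT) hg
      exact ⟨q w, Or.inr ⟨w, hw, hsep, rfl⟩⟩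
  choose r hr using hr
  have hrx : ∀ x, r (incl φ v x) = x := fun x => by
    obtain h | ⟨w, -, hsep, -⟩ := hr (incl φ v x)
    · exact incl_injective φ hT v h
    · rw [(base_eq_iff φ).2 ⟨x, (one_mul _).symm⟩] at hsep
      exact absurd hsep (EdgeTree.not_separates_self _ _)
  -- Neighbours leaving through the same wall have the same image; otherwise that wall separates
  -- them, so it is near `g` and the retraction moves `g` little.
  have key : ∀ g h, (mulCayley S).Adj g h →
      r g = r h ∨ (mulCayley S).dist g (incl φ v (r g)) ≤ 1 + n + (d + i) := by
    intro g h hgh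
    obtain hg | ⟨w, hw, hsep, hwr⟩ := hr g
    · exact Or.inr (by rw [hg]; simp)
    by_cases hsep' : (bassSerreTree φ hT).Separates w (base φ v 1) (base φ v h)
    · left
      obtain hh | ⟨w', hw', hsep'', hwr'⟩ := hr h
      · rw [← hh, ← (base_eq_iff φ).2 ⟨r h, (one_mul _).symm⟩] at hsep'
        exact absurd hsep' (EdgeTree.not_separates_self _ _)
      · rw [hwr, hwr', hw.eq_of_separates hw' hsep' hsep'']
    · right
      obtain ⟨e, c, rfl, hc⟩ := hn g h w (by unfold EdgeTree.Separates at *; tauto)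
      rw [dist_eq_one_iff_adj.2 hgh] at hc
      have h1 := hq _ hw e c rfl
      have h2 := hG.dist_triangle (u := g) (v := c) (w := incl φ v (r g))
      rw [← hwr] at h1
      omega
  refine ⟨2 * (1 + n + (d + i)) + 1, r, hrx, fun g h hgh => ?_⟩
  obtain h1 | h1 := key g h hgh
  · simp [h1]
  obtain h2 | h2 := key h g hgh.symm
  · simp [h2]
  have h3 := hG.dist_triangle (u := incl φ v (r g)) (v := g) (w := incl φ v (r h))
  have h4 := hG.dist_triangle (u := g) (v := h) (w := incl φ v (r h))
  rw [dist_eq_one_iff_adj.2 hgh] at h4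
  rw [SimpleGraph.dist_comm] at h1
  omega

/-- The lower bound comes from the retraction: by injectivity an `M`-ball of `G` meets the vertex
group in a finite set, so the retraction is Lipschitz for the intrinsic word metric too. -/
theorem exists_isCoarseEmbedding_incl [Finite E] [∀ e, Finite (𝒢.edgeGroup e)]
    (hT : 𝒢.IsSpanningTree T) (hS : IsFiniteGeneratingSet S) {v : V} {S' : Set (𝒢.vertexGroup v)}
    (hS' : IsFiniteGeneratingSet S') (g : G) :
    ∃ a, IsCoarseEmbedding (mulCayley S') (mulCayley S) a fun x => g * incl φ v x := by
  obtain ⟨c, hc⟩ := hS'.exists_lipschitz hS (incl φ v)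
  obtain ⟨M, r, hr, hM⟩ := exists_coarse_retraction hT hS (φ := φ) v
  have hfin : (incl φ v ⁻¹' {h | (mulCayley S).dist 1 h ≤ M}).Finite :=
    (hS.finite_ball 1 M).preimage (incl_injective φ hT v).injOn
  obtain ⟨L, hL⟩ := (hfin.image fun x => (mulCayley S').dist 1 x).bddAbove
  have hlip := (mulCayley_connected hS.2).dist_le_mul_of_adj (mulCayley_connected hS'.2) (f := r)
    (c := L) fun p q hpq => by
      rw [mulCayley_dist_eq hS'.2]
      refine hL ⟨_, ?_, rfl⟩
      have := hM p q hpq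
      rw [mulCayley_dist_eq hS.2, ← map_inv, ← map_mul] at this
      exact this
  refine ⟨c + L, fun x y => ?_⟩
  have h1 := hc x y
  have h2 := hlip (incl φ v x) (incl φ v y)
  rw [hr, hr] at h2
  simp only [mulCayley_dist_mul_left hS.2]
  constructor <;> nlinarith

theorem vertexSpace_base (v : V) (g x : G) :
    x ∈ 𝒢.vertexSpace φ (base φ v g) ↔ ∃ y, x = g * incl φ v y := by
  rw [mem_vertexSpace_iff, eq_comm, base_eq_iff]

end GraphOfGroups

/-! ### Maps between subspaces induced by a quasi-isometry -/

/-- Used with `j` an undistorted subspace, to replace a map landing near it by a map into it; also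
with `f = id`, to obtain a quasi-inverse of `j`. -/
theorem IsCoarseEmbedding.of_dist_le {P Q R : Type*} {X : SimpleGraph P} {Y : SimpleGraph Q}
    {Z : SimpleGraph R} (hZ : Z.Connected) {a b r : ℕ} {f : P → R} {j : Q → R} {F : P → Q}
    (hf : IsCoarseEmbedding X Z a f) (hj : IsCoarseEmbedding Y Z b j)
    (hF : ∀ p, Z.dist (f p) (j (F p)) ≤ r) :
    IsCoarseEmbedding X Y (a * b + 2 * r * a + 2 * r * b + a + b) F := by
  intro p q
  have h1 := hZ.dist_triangle (u := j (F p)) (v := f p) (w := j (F q))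
  have h2 := hZ.dist_triangle (u := f p) (v := f q) (w := j (F q))
  have h3 := hZ.dist_triangle (u := f p) (v := j (F p)) (w := f q)
  have h4 := hZ.dist_triangle (u := j (F p)) (v := j (F q)) (w := f q)
  rw [SimpleGraph.dist_comm (u := j (F p)) (v := f p)] at h1
  rw [SimpleGraph.dist_comm (u := j (F q)) (v := f q)] at h4
  have hp := hF p
  have hq := hF q
  have hfpq := hf p q
  have hjpq := hj (F p) (F q)
  have h5 := Nat.mul_le_mul_left b
    (show Z.dist (j (F p)) (j (F q)) ≤ a * X.dist p q + a + 2 * r by omega)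
  have h6 := Nat.mul_le_mul_left a
    (show Z.dist (f p) (f q) ≤ b * Y.dist (F p) (F q) + b + 2 * r by omega)
  have h7 : 0 ≤ (2 * r * a + 2 * r * b + a + b) * X.dist p q := Nat.zero_le _
  have h8 : 0 ≤ (2 * r * a + 2 * r * b + a + b) * Y.dist (F p) (F q) := Nat.zero_le _
  constructor <;> nlinarith

/-! ### Proofs of the two assertions -/

namespace GraphOfGroups

theorem exists_quasiIsometric_vertexGroup {V₁ : Type u₁} {E₁ : Type u₂} {V₂ : Type u₅}
    {E₂ : Type u₆} {𝒢₁ : GraphOfGroups.{u₁, u₂, u₃, u₄} V₁ E₁}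
    {𝒢₂ : GraphOfGroups.{u₅, u₆, u₇, u₈} V₂ E₂} {T₁ : Set E₁} {T₂ : Set E₂} {G₁ : Type u₉}
    {G₂ : Type u₁₀} [Group G₁] [Group G₂] (h𝒢₁ : 𝒢₁.IsTerminal) (h𝒢₂ : 𝒢₂.IsTerminal)
    (hT₁ : 𝒢₁.IsSpanningTree T₁) (hT₂ : 𝒢₂.IsSpanningTree T₂)
    (φ₁ : 𝒢₁.FundamentalGroup T₁ ≃* G₁) (φ₂ : 𝒢₂.FundamentalGroup T₂ ≃* G₂)
    (hqi : QuasiIsometricGroups G₁ G₂) (v : V₁) (hv : IsOneEnded (𝒢₁.vertexGroup v)) :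
    ∃ w : V₂, IsOneEnded (𝒢₂.vertexGroup w) ∧
      QuasiIsometricGroups (𝒢₁.vertexGroup v) (𝒢₂.vertexGroup w) := by
  have := h𝒢₁.finite_edges
  have := h𝒢₂.finite_edges
  have := h𝒢₁.finite_edgeGroup
  have := h𝒢₂.finite_edgeGroup
  obtain ⟨S₁, S₂, hS₁, hS₂, f, ⟨A, B, hf⟩, r, hr⟩ := hqi
  obtain ⟨hinf, -⟩ := hv.exists_radius
  obtain ⟨Sv, hSv, -⟩ := id hv
  have hG₁ := mulCayley_connected hS₁.2
  have hG₂ := mulCayley_connected hS₂.2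
  replace hf := hf.isCoarseEmbedding
  set a := ⌈A + B + A * B⌉₊
  choose f' hf' using hr
  obtain ⟨b, hf'b⟩ : ∃ b, IsCoarseEmbedding (mulCayley S₂) (mulCayley S₁) b f' :=
    ⟨_, IsCoarseEmbedding.of_dist_le hG₂ (f := id) (a := 1)
      (fun p q => ⟨by simp, by simp⟩) hf hf'⟩
  obtain ⟨a₁, hι₁⟩ := exists_isCoarseEmbedding_incl hT₁ hS₁ (φ := φ₁) hSv 1
  have hfι := hf.comp hι₁
  obtain ⟨R, hR⟩ := exists_vertexSpace_of_isOneEnded hT₂ hS₂ (φ := φ₂) hv hSv (a₁ * a + a₁ + a)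
  obtain ⟨X, hX⟩ := hR _ hfι
  obtain ⟨w, g, rfl⟩ := exists_base_eq φ₂ X
  have hF : ∀ h, ∃ y, (mulCayley S₂).dist (f (1 * incl φ₁ v h)) (g * incl φ₂ w y) ≤ R := fun h => by
    obtain ⟨x, hx, hd⟩ := hX h
    obtain ⟨y, rfl⟩ := (vertexSpace_base w g x).1 hx
    exact ⟨y, hd⟩
  choose F hF using hF
  -- A finite vertex space has a finite `R`-neighbourhood, which cannot contain the image of an
  -- infinite group under a finite-to-one map.
  have hw : IsOneEnded (𝒢₂.vertexGroup w) := by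
    refine (h𝒢₂.vertexGroup w).resolve_left fun hfin => ?_
    have hcov : (⋃ y, {q | (mulCayley S₂).dist (g * incl φ₂ w y) q ≤ R}).Finite :=
      Set.finite_iUnion fun y => hS₂.finite_ball _ _
    refine Set.infinite_univ ((hfι.finite_preimage hSv hcov).subset fun h _ => ?_)
    refine Set.mem_iUnion.2 ⟨F h, ?_⟩
    have := hF h
    rw [SimpleGraph.dist_comm] at this
    exact this
  obtain ⟨Sw, hSw, -⟩ := id hw
  obtain ⟨a₂, hι₂⟩ := exists_isCoarseEmbedding_incl hT₂ hS₂ (φ := φ₂) hSw g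
  obtain ⟨R', hR'⟩ := exists_vertexSpace_of_isOneEnded hT₁ hS₁ (φ := φ₁) hw hSw (a₂ * b + a₂ + b)
  obtain ⟨Y, hY⟩ := hR' _ (hf'b.comp hι₂)
  -- Every `p` in the original vertex space is close to `f' (f p)`, hence to `f'` of a nearby point
  -- of the space in `G₂`, hence to `Y`. Infinitely many such `p` exclude distinct spaces.
  have hYv : base φ₁ v 1 = Y := by
    by_contra hne
    have hfin := finite_near_vertexSpaces hT₁ hS₁ hne ((a * r + a) + (b * R + b) + R')
    refine Set.infinite_univ ((hι₁.finite_preimage hSv hfin).subset fun h _ => ⟨⟨1 * incl φ₁ v h, ?_, ?_⟩, ?_⟩)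
    · exact (vertexSpace_base v 1 _).2 ⟨h, rfl⟩
    · simp
    · obtain ⟨y, hy, hd⟩ := hY (F h)
      refine ⟨y, hy, ?_⟩
      simp only [Function.comp] at hd
      change (mulCayley S₁).dist (1 * incl φ₁ v h) y ≤ _
      set p := 1 * incl φ₁ v h
      set q := g * incl φ₂ w (F h)
      have h1 := hG₁.dist_triangle (u := p) (v := f' (f p)) (w := y)
      have h2 := hG₁.dist_triangle (u := f' (f p)) (v := f' q) (w := y)
      have h3 := (hf p (f' (f p))).2
      have h4 := Nat.mul_le_mul_left a (hf' (f p))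
      have h5 := (hf'b (f p) q).1
      have h6 : b * (mulCayley S₂).dist (f p) q ≤ b * R := Nat.mul_le_mul_left b (hF h)
      omega
  subst hYv
  have hFqi := IsCoarseEmbedding.of_dist_le hG₂ hfι hι₂ hF
  refine ⟨w, hw, Sv, Sw, hSv, hSw, F, ⟨_, _, hFqi.isQuasiIsometricEmbedding⟩,
    -- The bound follows `q`, `f (f' q)`, `f p`, `q'` in `G₂`, where `p` is a point of the vertex
    -- space near `f' q`; `a₂` converts it to the word metric of the vertex group.
    a₂ * (r + (a * R' + a) + R) + a₂, fun y => ?_⟩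
  obtain ⟨z, hz, hd⟩ := hY y
  obtain ⟨h, rfl⟩ := (vertexSpace_base v 1 z).1 hz
  refine ⟨h, ?_⟩
  simp only [Function.comp] at hd
  have h0 := hF h
  set p := 1 * incl φ₁ v h
  have h1 : _ ≤ a₂ * (mulCayley S₂).dist (g * incl φ₂ w y) (g * incl φ₂ w (F h)) + a₂ :=
    (hι₂ y (F h)).2
  set q := g * incl φ₂ w y
  set q' := g * incl φ₂ w (F h)
  have h2 := hG₂.dist_triangle (u := q) (v := f (f' q)) (w := q')
  have h3 := hG₂.dist_triangle (u := f (f' q)) (v := f p) (w := q')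
  have h4 := hf' q
  have h5 := (hf (f' q) p).1
  have h6 := Nat.mul_le_mul_left a hd
  have h7 := Nat.mul_le_mul_left a₂
    (show (mulCayley S₂).dist q q' ≤ r + (a * R' + a) + R by omega)
  exact_mod_cast h1.trans (by omega)

theorem exists_unique_vertexSpace {V : Type u₁} {E : Type u₂}
    {𝒢 : GraphOfGroups.{u₁, u₂, u₃, u₄} V E} {T : Set E} {G : Type u₉} {H : Type u₁₀} [Group G]
    [Group H] (φ : 𝒢.FundamentalGroup T ≃* G) (h𝒢 : 𝒢.IsTerminal) (hT : 𝒢.IsSpanningTree T)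
    (hH : IsOneEnded H) {S : Set G} {S' : Set H} (hS : IsFiniteGeneratingSet S)
    (hS' : IsFiniteGeneratingSet S') (A B : ℝ) :
    ∃ R : ℕ, ∀ f : H → G,
      IsQuasiIsometricEmbedding (mulCayley S') (mulCayley S) A B f →
      ∃! X : 𝒢.VertexSpaceIndex φ,
        ∀ h : H, ∃ x ∈ 𝒢.vertexSpace φ X, (mulCayley S).dist (f h) x ≤ R := by
  have := h𝒢.finite_edges
  have := h𝒢.finite_edgeGroup
  obtain ⟨hinf, -⟩ := hH.exists_radius
  obtain ⟨R, hR⟩ := exists_vertexSpace_of_isOneEnded hT hS (φ := φ) hH hS' ⌈A + B + A * B⌉₊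
  refine ⟨R, fun f hf => ?_⟩
  obtain ⟨X, hX⟩ := hR f hf.isCoarseEmbedding
  refine ⟨X, hX, fun Y hY => ?_⟩
  by_contra hne
  exact Set.infinite_univ ((hf.isCoarseEmbedding.finite_preimage hS'
    (finite_near_vertexSpaces hT hS hne R)).subset fun h _ => ⟨hY h, hX h⟩)

end GraphOfGroups

theorem mainTheorem5 :
    (∀ {V₁ : Type u₁} {E₁ : Type u₂} {V₂ : Type u₅} {E₂ : Type u₆}
      (𝒢₁ : GraphOfGroups.{u₁, u₂, u₃, u₄} V₁ E₁) (𝒢₂ : GraphOfGroups.{u₅, u₆, u₇, u₈} V₂ E₂)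
      (T₁ : Set E₁) (T₂ : Set E₂) (G₁ : Type u₉) (G₂ : Type u₁₀) [Group G₁] [Group G₂],
      𝒢₁.IsTerminal → 𝒢₂.IsTerminal → 𝒢₁.IsSpanningTree T₁ → 𝒢₂.IsSpanningTree T₂ →
      (𝒢₁.FundamentalGroup T₁ ≃* G₁) → (𝒢₂.FundamentalGroup T₂ ≃* G₂) →
      QuasiIsometricGroups G₁ G₂ →
      ∀ v : V₁, IsOneEnded (𝒢₁.vertexGroup v) →
        ∃ w : V₂, IsOneEnded (𝒢₂.vertexGroup w) ∧
          QuasiIsometricGroups (𝒢₁.vertexGroup v) (𝒢₂.vertexGroup w)) ∧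
    (∀ {V : Type u₁} {E : Type u₂} (𝒢 : GraphOfGroups.{u₁, u₂, u₃, u₄} V E) (T : Set E)
      (G : Type u₉) (H : Type u₁₀) [Group G] [Group H] (φ : 𝒢.FundamentalGroup T ≃* G),
      𝒢.IsTerminal → 𝒢.IsSpanningTree T → IsOneEnded H →
      ∀ (S : Set G) (S' : Set H), IsFiniteGeneratingSet S → IsFiniteGeneratingSet S' →
      ∀ A B : ℝ, ∃ R : ℕ, ∀ f : H → G,
        IsQuasiIsometricEmbedding (SimpleGraph.mulCayley S') (SimpleGraph.mulCayley S) A B f →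
        ∃! X : 𝒢.VertexSpaceIndex φ,
          ∀ h : H, ∃ x ∈ 𝒢.vertexSpace φ X, (SimpleGraph.mulCayley S).dist (f h) x ≤ R) := by
  refine ⟨?_, ?_⟩
  · intro V₁ E₁ V₂ E₂ 𝒢₁ 𝒢₂ T₁ T₂ G₁ G₂ _ _ h₁ h₂ hT₁ hT₂ φ₁ φ₂ hqi v hv
    exact GraphOfGroups.exists_quasiIsometric_vertexGroup h₁ h₂ hT₁ hT₂ φ₁ φ₂ hqi v hv
  · intro V E 𝒢 T G H _ _ φ h𝒢 hT hH S S' hS hS' A B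
    exact GraphOfGroups.exists_unique_vertexSpace φ h𝒢 hT hH hS hS' A B
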